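/- Let $q$ be a prime power, let $n,d\ge 1$ be integers, and let $\sigma$ be an automorphism of $\mathbb{F}_{q^n}$ whose fixed field is $\mathbb{F}_q$. Let $R=\mathbb{F}_{q^n}[t;\sigma]$ be the skew polynomial ring, i.e. polynomials in $t$ with coefficients in $\mathbb{F}_{q^n}$, termwise addition, and multiplication determined by $ta=a^{\sigma}t$. An element $f\in R$ of degree $d$ is called irreducible if there are no $a,b\in R$ of degree less than $d$ with $f=ab$. For $f\in R$ irreducible of degree $d$, let $\mathbb{S}_f$ be the additive group of all elements of $R$ of degree less than $d$, with the multiplication $a\circ_f b := ab \bmod_r f$, the remainder of $ab$ on right division by $f$ (the unique $r$ with $\deg r<d$ and $ab=uf+r$ for some $u\in R$). A finite semifield is a finite, not necessarily associative algebra with at least two elements, with both distributive laws, without zero divisors, and with a multiplicative identity. Two finite semifields $(\mathbb{S},\circ)$ and $(\hat{\mathbb{S}},\hat\circ)$ are isotopic if there are additive bijections $F,G,H:\mathbb{S}\to\hat{\mathbb{S}}$ with $F(x)\mathbin{\hat\circ}G(y)=H(x\circ y)$ for all $x,y\in\mathbb{S}$. Let $I(q,d)$ be the set of monic irreducible polynomials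 of degree $d$ in $\mathbb{F}_q[y]$, and let the group $G=\Gamma L(1,q)=\mathbb{F}_q^{\times}\rtimes \mathrm{Aut}(\mathbb{F}_q)$ act on $I(q,d)$ by $$f^{(\lambda,\rho)}(y)=\lambda^{-d}f^{\rho}(\lambda y),\qquad \lambda\in\mathbb{F}_q^{\times},\ \rho\in\mathrm{Aut}(\mathbb{F}_q),$$ where $f^{\rho}$ is obtained by applying $\rho$ to the coefficients of $f$. Then every $\mathbb{S}_f$ with $f\in R$ irreducible of degree $d$ is a semifield of order $q^{nd}$, and the number of isotopism classes of these semifields $\mathbb{S}_f$ is at most the number of $G$-orbits on $I(q,d)$. -/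

import Mathlib

open scoped Polynomial

noncomputable section

namespace SkewSemifield

universe u v

/-! ### Skew polynomial rings `K[t;σ]` -/

section SkewRing

variable {K : Type u} [Field K]

/-- The field `K`, tagged with the automorphism `σ` by which the indeterminate acts on it. -/
def Twisted (_σ : K ≃+* K) : Type u := K

instance (σ : K ≃+* K) : Field (Twisted σ) := inferInstanceAs (Field K)

instance (σ : K ≃+* K) [Finite K] : Finite (Twisted σ) := inferInstanceAs (Finite K)

/-- The additive monoid `ℕ` acts on `K` through the powers of `σ`. -/
instance (σ : K ≃+* K) : MulSemiringAction (Multiplicative ℕ) (Twisted σ) :=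
  MulSemiringAction.compHom K (powersHom (K ≃+* K) σ)

/-- The skew polynomial ring `R = K[t;σ]`: polynomials in `t` with coefficients (on the left) in
`K`, termwise addition, and multiplication determined by `t a = σ(a) t`. -/
abbrev SkewPoly (σ : K ≃+* K) : Type u := SkewPolynomial (Twisted σ)

variable {σ : K ≃+* K}

/-- The identity map of `K`, as an isomorphism onto the tagged copy of `K`. -/
def toTwisted (σ : K ≃+* K) : K ≃+* Twisted σ := RingEquiv.refl K

theorem phi_apply (a : K) :
    (SkewPolynomial.φ : Twisted σ →+* Twisted σ) (toTwisted σ a) = toTwisted σ (σ a) := by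
  change (powersHom (K ≃+* K) σ (Multiplicative.ofAdd 1)) a = σ a
  simp

/-- The commutation rule `t a = σ(a) t` of `K[t;σ]`. -/
theorem X_mul_C (a : K) :
    (SkewPolynomial.X : SkewPoly σ) * SkewPolynomial.C (toTwisted σ a) =
      SkewPolynomial.C (toTwisted σ (σ a)) * SkewPolynomial.X := by
  rw [SkewPolynomial.X, SkewPolynomial.monomial_mul_C, SkewPolynomial.C_mul_monomial,
    Function.iterate_one, phi_apply, one_mul, mul_one]

/-- The degree of a skew polynomial, with `degree 0 = ⊥`. -/
def degree (p : SkewPoly σ) : WithBot ℕ := p.support.max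

theorem degree_lt_iff (p : SkewPoly σ) (d : ℕ) :
    degree p < (d : WithBot ℕ) ↔ ∀ m, d ≤ m → p.coeff m = 0 := by
  change degree p < WithBot.some d ↔ _
  rw [degree, Finset.max, Finset.sup_lt_iff (WithBot.bot_lt_coe d)]
  constructor
  · intro h m hm
    by_contra hc
    have := WithBot.coe_lt_coe.1 (h m (SkewPolynomial.mem_support_iff.2 hc))
    omega
  · intro h m hm
    refine WithBot.coe_lt_coe.2 (lt_of_not_ge fun hdm => ?_)
    exact SkewPolynomial.mem_support_iff.1 hm (h m hdm)

theorem coeff_ne_zero_of_degree_eq {f : SkewPoly σ} {d : ℕ} (hf : degree f = d) :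
    f.coeff d ≠ 0 :=
  SkewPolynomial.mem_support_iff.1 (Finset.mem_of_max hf)

theorem coeff_monomial_mul (k : ℕ) (c : Twisted σ) (f : SkewPoly σ) (m : ℕ) :
    (SkewPolynomial.monomial k c * f).coeff (k + m) = c * (SkewPolynomial.φ)^[k] (f.coeff m) := by
  induction f using SkewPolynomial.induction with
  | h0 => simp [SkewPolynomial.coeff_zero]
  | ha j r q hj hr ih =>
    rw [mul_add, SkewPolynomial.coeff_add, ih, SkewPolynomial.monomial_mul_monomial,
      SkewPolynomial.coeff_add, SkewPolynomial.coeff_monomial, SkewPolynomial.coeff_monomial,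
      iterate_map_add, mul_add]
    by_cases h : j = m
    · simp [h]
    · simp [h]

/-- Right division: `p = u f + r` with `deg r < deg f`. -/
theorem exists_right_remainder (f p : SkewPoly σ) (d : ℕ) (hf : degree f = d) :
    ∃ r : SkewPoly σ, degree r < (d : WithBot ℕ) ∧ ∃ u : SkewPoly σ, p = u * f + r := by
  have hfd : f.coeff d ≠ 0 := coeff_ne_zero_of_degree_eq hf
  have hft : ∀ m, d + 1 ≤ m → f.coeff m = 0 := by
    rw [← degree_lt_iff, hf]; exact_mod_cast Nat.lt_succ_self d
  have key : ∀ (N : ℕ) (p : SkewPoly σ), degree p < ((d + N : ℕ) : WithBot ℕ) →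
      ∃ r : SkewPoly σ, degree r < (d : WithBot ℕ) ∧ ∃ u : SkewPoly σ, p = u * f + r := by
    intro N
    induction N with
    | zero => intro p hp; exact ⟨p, by simpa using hp, 0, by simp⟩
    | succ N ih =>
      intro p hp
      rw [degree_lt_iff] at hp
      have hne : (SkewPolynomial.φ)^[N] (f.coeff d) ≠ 0 := by
        rw [← RingHom.coe_pow]
        exact (map_ne_zero _).2 hfd
      let c : Twisted σ := p.coeff (N + d) / (SkewPolynomial.φ)^[N] (f.coeff d)
      obtain ⟨r, hr, u, hu⟩ := ih (p - SkewPolynomial.monomial N c * f) (by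
        rw [degree_lt_iff]
        intro m hm
        obtain ⟨j, rfl⟩ : ∃ j, m = N + j := ⟨m - N, by omega⟩
        rw [SkewPolynomial.coeff_sub, coeff_monomial_mul]
        rcases (show d ≤ j by omega).eq_or_lt with h | h
        · subst h
          simp only [c]
          rw [div_mul_cancel₀ _ hne, sub_self]
        · rw [hp _ (by omega), hft j h, iterate_map_zero, mul_zero, sub_zero])
      exact ⟨r, hr, u + SkewPolynomial.monomial N c, by
        rw [add_mul, add_right_comm, ← hu, sub_add_cancel]⟩
  obtain ⟨N, hN⟩ : ∃ N : ℕ, degree p < ((d + N : ℕ) : WithBot ℕ) := by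
    refine ⟨p.support.sup id + 1, (degree_lt_iff _ _).2 fun m hm => ?_⟩
    by_contra hc
    have : m ≤ p.support.sup id :=
      Finset.le_sup (f := id) (SkewPolynomial.mem_support_iff.2 hc)
    omega
  exact key N p hN

/-- An element `f` of `R` is irreducible if it is not a product of two elements of degree
smaller than `deg f`. (It is used below only for elements of degree at least `1`.) -/
def IsIrreducible (f : SkewPoly σ) : Prop :=
  ¬ ∃ a b : SkewPoly σ, degree a < degree f ∧ degree b < degree f ∧ f = a * b

/-- The irreducible elements of degree `d` in `R = K[t;σ]`. -/
def IrrPoly (σ : K ≃+* K) (d : ℕ) : Type u :=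
  {f : SkewPoly σ // degree f = (d : WithBot ℕ) ∧ IsIrreducible f}

/-- The additive group of the elements of `R` of degree strictly less than `d`. -/
def degreeLT (σ : K ≃+* K) (d : ℕ) : AddSubgroup (SkewPoly σ) where
  carrier := {a | degree a < (d : WithBot ℕ)}
  zero_mem' := (degree_lt_iff _ _).2 fun m _ => SkewPolynomial.coeff_zero m
  add_mem' := by
    intro a b ha hb
    simp only [Set.mem_ofPred_eq, degree_lt_iff] at *
    intro m hm
    rw [SkewPolynomial.coeff_add, ha m hm, hb m hm, add_zero]
  neg_mem' := by
    intro a ha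
    simp only [Set.mem_ofPred_eq, degree_lt_iff] at *
    intro m hm
    rw [SkewPolynomial.coeff_neg, ha m hm, neg_zero]

/-! ### The algebras `𝕊_f` -/

variable {d : ℕ}

/-- `p mod_r f`: the remainder of `p` on right division by `f`, the unique element `r` with
`deg r < deg f` and `p = u f + r` for some `u`. -/
def modRight (f : IrrPoly σ d) (p : SkewPoly σ) : SkewPoly σ :=
  (exists_right_remainder f.1 p d f.2.1).choose

theorem degree_modRight (f : IrrPoly σ d) (p : SkewPoly σ) :
    degree (modRight f p) < (d : WithBot ℕ) :=
  (exists_right_remainder f.1 p d f.2.1).choose_spec.1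

theorem modRight_spec (f : IrrPoly σ d) (p : SkewPoly σ) :
    ∃ u : SkewPoly σ, p = u * f.1 + modRight f p :=
  (exists_right_remainder f.1 p d f.2.1).choose_spec.2

/-- The underlying set of `𝕊_f`: the elements of `R` of degree less than `d = deg f`. -/
def Sf (_f : IrrPoly σ d) : Type u := degreeLT σ d

instance (f : IrrPoly σ d) : AddCommGroup (Sf f) := inferInstanceAs (AddCommGroup (degreeLT σ d))

/-- The multiplication `a ∘_f b = a b mod_r f` of `𝕊_f`. -/
instance (f : IrrPoly σ d) : Mul (Sf f) where
  mul a b := ⟨modRight f (a.1 * b.1), degree_modRight f _⟩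

end SkewRing

/-! ### Finite semifields and isotopism -/

/-- A finite semifield: a finite (not necessarily associative) algebra with at least two elements,
both distributive laws, no zero divisors, and a multiplicative identity. -/
structure IsFiniteSemifield (S : Type u) [AddCommGroup S] [Mul S] : Prop where
  finite : Finite S
  nontrivial : Nontrivial S
  left_distrib : ∀ x y z : S, x * (y + z) = x * y + x * z
  right_distrib : ∀ x y z : S, (x + y) * z = x * z + y * z
  eq_zero_or_eq_zero : ∀ x y : S, x * y = 0 → x = 0 ∨ y = 0
  exists_one : ∃ e : S, ∀ x : S, e * x = x ∧ x * e = x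

/-- Two semifields are isotopic if there are additive bijections `F, G, H` (equivalently,
non-singular maps that are linear over the prime field) with `F x ∘ G y = H (x ∘ y)`. -/
def Isotopic (S : Type u) (S' : Type v) [AddCommGroup S] [Mul S] [AddCommGroup S'] [Mul S'] :
    Prop :=
  ∃ F G H : S ≃+ S', ∀ x y : S, F x * G y = H (x * y)

/-- Isotopism of the semifields `𝕊_f`, as an equivalence relation on the irreducible elements `f`
of degree `d`. -/
def isotopismSetoid {K : Type u} [Field K] (σ : K ≃+* K) (d : ℕ) : Setoid (IrrPoly σ d) where
  r f g := Isotopic (Sf f) (Sf g)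
  iseqv :=
    { refl := fun _ => ⟨.refl _, .refl _, .refl _, fun _ _ => rfl⟩
      symm := by
        rintro f g ⟨F, G, H, h⟩
        refine ⟨F.symm, G.symm, H.symm, fun x y => ?_⟩
        rw [AddEquiv.eq_symm_apply, ← h, F.apply_symm_apply, G.apply_symm_apply]
      trans := by
        rintro f g k ⟨F, G, H, h⟩ ⟨F', G', H', h'⟩
        refine ⟨F.trans F', G.trans G', H.trans H', fun x y => ?_⟩
        simp only [AddEquiv.trans_apply]
        rw [h', h] }

/-- The isotopism classes of the semifields `𝕊_f`, `f` irreducible of degree `d` in `K[t;σ]`. -/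
abbrev IsotopismClasses {K : Type u} [Field K] (σ : K ≃+* K) (d : ℕ) : Type u :=
  Quotient (isotopismSetoid σ d)

instance {K : Type u} [Field K] [Finite K] (σ : K ≃+* K) (d : ℕ) : Finite (IrrPoly σ d) := by
  refine Finite.of_injective (β := Fin (d + 1) → Twisted σ) (fun f i => f.1.coeff i) ?_
  intro f g h
  refine Subtype.ext (SkewPolynomial.ext fun m => ?_)
  by_cases hm : m < d + 1
  · exact congrFun h ⟨m, hm⟩
  · have hz : ∀ f : IrrPoly σ d, f.1.coeff m = 0 := fun f =>
      (degree_lt_iff f.1 (d + 1)).1 (by rw [f.2.1]; exact_mod_cast Nat.lt_succ_self d) m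
        (not_lt.1 hm)
    rw [hz f, hz g]

/-! ### The action of `ΓL(1,q)` on monic irreducible polynomials -/

section Orbits

variable (F : Type u) [Field F]

/-- The action of `Aut(F)` on the multiplicative group of `F`. -/
def autUnits : (F ≃+* F) →* MulAut Fˣ where
  toFun ρ := Units.mapEquiv ρ.toMulEquiv
  map_one' := by ext; rfl
  map_mul' _ _ := by ext; rfl

/-- The group `ΓL(1,F)`: the semidirect product of `Fˣ` and `Aut(F)`, consisting of the pairs
`(c, ρ)`. -/
abbrev GammaL1 : Type u := Fˣ ⋊[autUnits F] (F ≃+* F)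

/-- The set of monic irreducible polynomials of degree `d` in `F[y]`. -/
def MonicIrr (d : ℕ) : Type u := {f : F[X] // f.Monic ∧ Irreducible f ∧ f.natDegree = d}

variable {F}

/-- The polynomial `c^{-d} f^ρ(c y)`, where `ρ` is applied to the coefficients of `f`. -/
def twistPoly (d : ℕ) (g : GammaL1 F) (f : F[X]) : F[X] :=
  Polynomial.C (((g.left : F)⁻¹) ^ d) *
    (f.map (g.right : F →+* F)).comp (Polynomial.C (g.left : F) * Polynomial.X)

theorem coeff_twistPoly (d : ℕ) (g : GammaL1 F) (f : F[X]) (m : ℕ) :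
    (twistPoly d g f).coeff m = ((g.left : F)⁻¹) ^ d * (g.right (f.coeff m) * (g.left : F) ^ m) := by
  rw [twistPoly, Polynomial.coeff_C_mul, Polynomial.comp_C_mul_X_coeff, Polynomial.coeff_map]
  rfl

theorem natDegree_twistPoly (d : ℕ) (g : GammaL1 F) (f : F[X]) :
    (twistPoly d g f).natDegree = f.natDegree := by
  rw [twistPoly, Polynomial.natDegree_C_mul (pow_ne_zero _ (inv_ne_zero g.left.ne_zero)),
    Polynomial.natDegree_comp, Polynomial.natDegree_C_mul_X _ g.left.ne_zero, mul_one,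
    Polynomial.natDegree_map]

theorem twistPoly_mul (d e : ℕ) (g : GammaL1 F) (a b : F[X]) :
    twistPoly (d + e) g (a * b) = twistPoly d g a * twistPoly e g b := by
  simp only [twistPoly, Polynomial.map_mul, Polynomial.mul_comp, pow_add, map_mul]
  ring

theorem twistPoly_one (d : ℕ) (f : F[X]) : twistPoly d 1 f = f := by
  ext m; simp [coeff_twistPoly]

theorem twistPoly_smul (d : ℕ) (g h : GammaL1 F) (f : F[X]) :
    twistPoly d (g * h) f = twistPoly d g (twistPoly d h f) := by
  ext m
  have hl : (((g * h).left : Fˣ) : F) = (g.left : F) * g.right (h.left : F) := rfl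
  have hr : (g * h).right (f.coeff m) = g.right (h.right (f.coeff m)) := rfl
  simp only [coeff_twistPoly, hl, hr, map_mul, map_pow, map_inv₀, mul_inv, mul_pow]
  ring

theorem twistPoly_irreducible (d : ℕ) (g : GammaL1 F) {f : F[X]} (hf : Irreducible f) :
    Irreducible (twistPoly d g f) := by
  refine ⟨fun hu => hf.not_isUnit ?_, fun a b hab => ?_⟩
  · rw [Polynomial.isUnit_iff_degree_eq_zero] at hu ⊢
    rw [Polynomial.degree_eq_natDegree hf.ne_zero]
    rw [← natDegree_twistPoly d g f, Polynomial.natDegree_eq_of_degree_eq_some hu]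
    rfl
  · have hfe : f = twistPoly d g⁻¹ a * twistPoly 0 g⁻¹ b := by
      rw [← twistPoly_mul, ← hab, add_zero, ← twistPoly_smul, inv_mul_cancel, twistPoly_one]
    have hab0 : a * b ≠ 0 := by
      intro h0
      apply hf.ne_zero
      rw [hfe, ← twistPoly_mul, h0]
      simp [twistPoly]
    have ha := left_ne_zero_of_mul hab0
    have hb := right_ne_zero_of_mul hab0
    refine (hf.isUnit_or_isUnit hfe).imp (fun h => ?_) (fun h => ?_)
    all_goals
      have h := Polynomial.natDegree_eq_zero_of_isUnit h
      rw [natDegree_twistPoly] at h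
      rw [Polynomial.isUnit_iff_degree_eq_zero, Polynomial.degree_eq_natDegree (by assumption), h]
      rfl

/-- The action `f ↦ c^{-d} f^ρ(c y)` of `ΓL(1,F)` on the monic irreducible polynomials of
degree `d` in `F[y]`. -/
instance (d : ℕ) : MulAction (GammaL1 F) (MonicIrr F d) where
  smul g f := ⟨twistPoly d g f.1, by
    have hd := natDegree_twistPoly d g f.1
    refine ⟨?_, twistPoly_irreducible d g f.2.2.1, hd.trans f.2.2.2⟩
    have hc : f.1.coeff d = 1 := by
      have := f.2.1.coeff_natDegree
      rwa [f.2.2.2] at this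
    rw [Polynomial.Monic, Polynomial.leadingCoeff, hd, f.2.2.2, coeff_twistPoly, hc, map_one,
      one_mul, ← mul_pow, inv_mul_cancel₀ g.left.ne_zero, one_pow]⟩
  one_smul f := Subtype.ext (twistPoly_one d f.1)
  mul_smul g h f := Subtype.ext (twistPoly_smul d g h f.1)

/-- The orbits of `ΓL(1,F)` on the monic irreducible polynomials of degree `d` in `F[y]`. -/
abbrev GammaL1Orbits (F : Type u) [Field F] (d : ℕ) : Type u :=
  MulAction.orbitRel.Quotient (GammaL1 F) (MonicIrr F d)

instance (d : ℕ) [Finite F] : Finite (MonicIrr F d) := by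
  refine Finite.of_injective (β := Fin (d + 1) → F) (fun f i => f.1.coeff i) ?_
  intro f g h
  refine Subtype.ext (Polynomial.ext fun m => ?_)
  by_cases hm : m < d + 1
  · exact congrFun h ⟨m, hm⟩
  · rw [Polynomial.coeff_eq_zero_of_natDegree_lt (by rw [f.2.2.2]; omega),
      Polynomial.coeff_eq_zero_of_natDegree_lt (by rw [g.2.2.2]; omega)]

end Orbits

end SkewSemifield

end

open scoped Polynomial

noncomputable section

namespace SkewSemifield

universe u v w

section SkewRing

variable {K : Type u} [Field K] {σ : K ≃+* K}

/-! ### Coefficients and degrees of skew polynomials -/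

/-! Write R = K[t;σ]. Sending a remainder to its class identifies 𝕊_f with the left module R/Rf, and
a ∘ b becomes the class of b acted on by a (`SfEquiv_mul`). Irreducibility of f makes R/Rf simple,
and a count shows that a nonzero element of degree less than d kills no nonzero vector; this
excludes zero divisors.

A module isomorphism R/Rf ≅ R/Rg gives an isotopism (`isotopic_of_linearEquiv`), so only the
isomorphism type of the simple module matters, and that type is read off from the centre. Each f
right divides P(t^n) for some monic irreducible P of degree d over F (`exists_central_multiple`;
Jacobson density and counting give the degree), and irreducible elements dividing the same P(t^n)
have isomorphic modules (`nonempty_linearEquiv`).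

Finally (λ, ρ) lifts to R: t goes to at, where a has norm λ, and coefficients are moved by an
extension of ρ to K. This takes P(t^n) to P^ρ(λ t^n) (`semilinearHom_centralHom`) and induces an
isomorphism of semifields (`isotopic_semilinear`). Hence f and g are isotopic as soon as their
polynomials share an orbit, and the map from classes to orbits obtained by choosing representatives
is injective. -/

theorem coeff_mul (p q : SkewPoly σ) (m : ℕ) :
    (p * q).coeff m = ∑ i ∈ Finset.range (m + 1),
      p.coeff i * (SkewPolynomial.φ)^[i] (q.coeff (m - i)) := by
  induction p using SkewPolynomial.induction with
  | h0 => simp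
  | ha j r p hj hr ih =>
    have key : (SkewPolynomial.monomial j r * q).coeff m =
        if j ≤ m then r * (SkewPolynomial.φ)^[j] (q.coeff (m - j)) else 0 := by
      split_ifs with h
      · obtain ⟨l, rfl⟩ := Nat.exists_eq_add_of_le h
        rw [coeff_monomial_mul, Nat.add_sub_cancel_left]
      · clear ih
        induction q using SkewPolynomial.induction with
        | h0 => simp
        | ha i s q hi hs ih =>
          rw [mul_add, SkewPolynomial.coeff_add, ih, SkewPolynomial.monomial_mul_monomial,
            SkewPolynomial.coeff_monomial, if_neg (by omega), add_zero]
    rw [add_mul, SkewPolynomial.coeff_add, ih, key]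
    simp only [SkewPolynomial.coeff_add, add_mul, Finset.sum_add_distrib,
      SkewPolynomial.coeff_monomial, ite_mul, zero_mul, Finset.sum_ite_eq, Finset.mem_range,
      Nat.lt_succ_iff]

theorem coeff_C_mul (a : Twisted σ) (p : SkewPoly σ) (m : ℕ) :
    (SkewPolynomial.C a * p).coeff m = a * p.coeff m := by
  simpa using coeff_monomial_mul 0 a p m

theorem coeff_mul_C (a : Twisted σ) (p : SkewPoly σ) (m : ℕ) :
    (p * SkewPolynomial.C a).coeff m = p.coeff m * (SkewPolynomial.φ)^[m] a := by
  rw [coeff_mul, Finset.sum_eq_single_of_mem m (by simp)]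
  · simp
  · intro i hi him
    rw [Finset.mem_range] at hi
    rw [SkewPolynomial.coeff_C_ne_zero (by omega), iterate_map_zero, mul_zero]

theorem coeff_X_mul (p : SkewPoly σ) (m : ℕ) :
    ((SkewPolynomial.X : SkewPoly σ) * p).coeff (m + 1) = SkewPolynomial.φ (p.coeff m) := by
  have := coeff_monomial_mul 1 1 p m
  rw [add_comm 1 m] at this
  simpa [SkewPolynomial.X] using this

theorem coeff_X_mul_zero (p : SkewPoly σ) :
    ((SkewPolynomial.X : SkewPoly σ) * p).coeff 0 = 0 := by
  simp [coeff_mul]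

theorem coeff_mul_X (p : SkewPoly σ) (m : ℕ) :
    (p * (SkewPolynomial.X : SkewPoly σ)).coeff (m + 1) = p.coeff m := by
  rw [coeff_mul, Finset.sum_eq_single_of_mem m (by simp)]
  · simp
  · intro i hi him
    rw [Finset.mem_range] at hi
    rw [SkewPolynomial.coeff_X_of_ne_one (by omega), iterate_map_zero, mul_zero]

theorem coeff_mul_X_zero (p : SkewPoly σ) :
    (p * (SkewPolynomial.X : SkewPoly σ)).coeff 0 = 0 := by
  simp [coeff_mul]

theorem degree_zero : degree (0 : SkewPoly σ) = ⊥ := by simp [degree]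

theorem degree_eq_bot {p : SkewPoly σ} : degree p = ⊥ ↔ p = 0 := by
  simp [degree, Finset.max_eq_bot]

theorem degree_eq_iff {p : SkewPoly σ} {k : ℕ} :
    degree p = k ↔ p.coeff k ≠ 0 ∧ ∀ m, k < m → p.coeff m = 0 := by
  constructor
  · intro h
    refine ⟨coeff_ne_zero_of_degree_eq h, fun m hm => ?_⟩
    exact (degree_lt_iff p (k + 1)).1 (by rw [h]; exact_mod_cast Nat.lt_succ_self k) m hm
  · rintro ⟨h1, h2⟩
    refine le_antisymm (Order.le_of_lt_succ ?_) ?_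
    · exact (degree_lt_iff p (k + 1)).2 h2
    · exact Finset.le_max (SkewPolynomial.mem_support_iff.2 h1)

theorem exists_degree_eq {p : SkewPoly σ} (hp : p ≠ 0) : ∃ k : ℕ, degree p = k := by
  obtain ⟨k, hk⟩ := WithBot.ne_bot_iff_exists.1 (mt degree_eq_bot.1 hp)
  exact ⟨k, hk.symm⟩

theorem iterate_phi_ne_zero {a : Twisted σ} (ha : a ≠ 0) (k : ℕ) :
    (SkewPolynomial.φ)^[k] a ≠ 0 := by
  rw [← RingHom.coe_pow]
  exact (map_ne_zero _).2 ha

/-- Only one term contributes to the top coefficient, and it is nonzero because `φ` is injective.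
With the degree of 0 equal to `⊥` this also says that R has no zero divisors. -/
theorem degree_mul (p q : SkewPoly σ) : degree (p * q) = degree p + degree q := by
  by_cases hp : p = 0
  · simp [hp, degree_zero]
  by_cases hq : q = 0
  · simp [hq, degree_zero]
  obtain ⟨k, hk⟩ := exists_degree_eq hp
  obtain ⟨l, hl⟩ := exists_degree_eq hq
  rw [hk, hl, ← Nat.cast_add, degree_eq_iff]
  rw [degree_eq_iff] at hk hl
  constructor
  · rw [coeff_mul, Finset.sum_eq_single_of_mem k (by simp)]
    · rw [Nat.add_sub_cancel_left]
      exact mul_ne_zero hk.1 (iterate_phi_ne_zero hl.1 k)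
    · intro i _ hik
      rcases lt_or_gt_of_ne hik with h | h
      · rw [hl.2 _ (by omega), iterate_map_zero, mul_zero]
      · rw [hk.2 _ h, zero_mul]
  · intro m hm
    rw [coeff_mul]
    refine Finset.sum_eq_zero fun i _ => ?_
    rcases le_or_gt i k with h | h
    · rw [hl.2 _ (by omega), iterate_map_zero, mul_zero]
    · rw [hk.2 _ h, zero_mul]

theorem degree_C {a : Twisted σ} (ha : a ≠ 0) : degree (SkewPolynomial.C a : SkewPoly σ) = 0 :=
  (degree_eq_iff (k := 0)).2 ⟨by simpa using ha, fun _ hm => SkewPolynomial.coeff_C_ne_zero hm.ne'⟩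

theorem eq_C_of_degree_lt_one {p : SkewPoly σ} (hp : degree p < (1 : ℕ)) :
    p = SkewPolynomial.C (p.coeff 0) := by
  rw [degree_lt_iff] at hp
  ext m
  rw [SkewPolynomial.coeff_C]
  split_ifs with h
  · rw [h]
  · exact hp m (by omega)

theorem isUnit_of_degree_eq_zero {p : SkewPoly σ} (hp : degree p = 0) : IsUnit p := by
  have h0 : p.coeff 0 ≠ 0 := coeff_ne_zero_of_degree_eq hp
  rw [eq_C_of_degree_lt_one (p := p) (by rw [hp]; exact_mod_cast zero_lt_one)]
  exact (isUnit_iff_ne_zero.2 h0).map SkewPolynomial.CRingHom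

/-- Every left ideal of `K[t;σ]` is principal. -/
theorem exists_span_singleton_eq (I : Submodule (SkewPoly σ) (SkewPoly σ)) :
    ∃ h : SkewPoly σ, I = Submodule.span (SkewPoly σ) {h} := by
  classical
  -- Having a natural number as degree means being nonzero, so the split is on `I ≠ 0`. An element
  -- of least degree generates, since right remainders modulo it stay in `I`.
  by_cases hI : ∃ k : ℕ, ∃ h ∈ I, degree h = k
  · obtain ⟨h, hh, hk⟩ := Nat.find_spec hI
    refine ⟨h, le_antisymm (fun p hp => ?_) ?_⟩
    · obtain ⟨r, hr, w, hw⟩ := exists_right_remainder h p _ hk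
      have hrI : r ∈ I := by
        rw [show r = p - w * h by rw [hw]; abel]
        exact I.sub_mem hp (I.smul_mem w hh)
      have hr0 : r = 0 := by
        by_contra hne
        obtain ⟨j, hj⟩ := exists_degree_eq hne
        rw [hj] at hr
        exact Nat.find_min hI (by exact_mod_cast hr) ⟨r, hrI, hj⟩
      rw [hw, hr0, add_zero]
      exact Submodule.mem_span_singleton.2 ⟨w, rfl⟩
    · rwa [Submodule.span_singleton_le_iff_mem]
  · refine ⟨0, ?_⟩
    rw [Submodule.span_zero_singleton, eq_bot_iff]
    intro p hp
    by_contra hne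
    obtain ⟨k, hk⟩ := exists_degree_eq (p := p) hne
    exact hI ⟨k, p, hp, hk⟩

/-! ### The module `K[t;σ] / K[t;σ] f` -/

variable {d : ℕ}

/-- The left module `K[t;σ] / K[t;σ] f`. -/
abbrev QuotMod (f : SkewPoly σ) : Type u :=
  SkewPoly σ ⧸ Submodule.span (SkewPoly σ) ({f} : Set (SkewPoly σ))

/-- The class of `p` in `K[t;σ] / K[t;σ] f`. -/
abbrev quotMk (f : SkewPoly σ) : SkewPoly σ →ₗ[SkewPoly σ] QuotMod f :=
  Submodule.mkQ _

theorem quotMk_eq_zero {f p : SkewPoly σ} : quotMk f p = 0 ↔ ∃ w, w * f = p := by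
  simp [quotMk, Submodule.Quotient.mk_eq_zero, Submodule.mem_span_singleton]

/-- A left ideal above Rf is some Rh with f = ah. Irreducibility forces a or h to have degree 0,
hence to be a unit, so Rh is Rf or R; `1 ≤ d` makes Rf proper. -/
theorem isSimpleModule_quotMod {f : SkewPoly σ} (hd : 1 ≤ d) (hf : degree f = d)
    (hirr : IsIrreducible f) : IsSimpleModule (SkewPoly σ) (QuotMod f) := by
  rw [isSimpleModule_iff_isCoatom]
  constructor
  · intro h
    have h1 : (1 : SkewPoly σ) ∈ Submodule.span (SkewPoly σ) {f} := h ▸ Submodule.mem_top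
    obtain ⟨w, hw⟩ := Submodule.mem_span_singleton.1 h1
    have h2 := congrArg degree hw
    have h3 : degree (1 : SkewPoly σ) = 0 := degree_C one_ne_zero
    have hw0 : w ≠ 0 := by rintro rfl; simp at hw
    obtain ⟨k, hk⟩ := exists_degree_eq hw0
    rw [smul_eq_mul, degree_mul, h3, hk, hf] at h2
    norm_cast at h2
    omega
  · intro I hI
    obtain ⟨h, rfl⟩ := exists_span_singleton_eq I
    obtain ⟨a, ha⟩ := Submodule.mem_span_singleton.1
      (hI.le (Submodule.mem_span_singleton_self f))
    rw [smul_eq_mul] at ha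
    have hf0 : f ≠ 0 := by rintro rfl; rw [degree_zero] at hf; exact absurd hf (by simp)
    obtain ⟨k, hk⟩ := exists_degree_eq (p := a) (by rintro rfl; simp at ha; exact hf0 ha.symm)
    obtain ⟨l, hl⟩ := exists_degree_eq (p := h) (by rintro rfl; simp at ha; exact hf0 ha.symm)
    have hdeg := congrArg degree ha
    rw [degree_mul, hk, hl, hf] at hdeg
    norm_cast at hdeg
    by_cases hk0 : k = 0
    · exfalso
      subst hk0
      obtain ⟨w, rfl⟩ := isUnit_of_degree_eq_zero hk
      refine hI.not_ge ?_
      rw [Submodule.span_singleton_le_iff_mem, Submodule.mem_span_singleton]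
      exact ⟨(w⁻¹ : (SkewPoly σ)ˣ), by rw [← ha, smul_eq_mul, ← mul_assoc]; simp⟩
    · by_cases hl0 : l = 0
      · subst hl0
        obtain ⟨w, rfl⟩ := isUnit_of_degree_eq_zero hl
        rw [eq_top_iff]
        intro p _
        exact Submodule.mem_span_singleton.2
          ⟨p * (w⁻¹ : (SkewPoly σ)ˣ), by rw [smul_eq_mul, mul_assoc]; simp⟩
      · exfalso
        refine hirr ⟨a, h, ?_, ?_, ha.symm⟩
        · rw [hk, hf]; exact_mod_cast (by omega)
        · rw [hl, hf]; exact_mod_cast (by omega)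

/-- The elements of degree less than `deg f` represent the classes modulo `f`. -/
def degreeLTEquiv {f : SkewPoly σ} (hf : degree f = d) : degreeLT σ d ≃+ QuotMod f :=
  AddEquiv.ofBijective ((quotMk f).toAddMonoidHom.comp (degreeLT σ d).subtype) <| by
    constructor
    · rw [injective_iff_map_eq_zero]
      rintro ⟨p, hp⟩ h0
      obtain ⟨w, hw⟩ := quotMk_eq_zero.1 h0
      change w * f = p at hw
      refine Subtype.ext ?_
      change degree p < d at hp
      change p = 0
      by_cases hw0 : w = 0
      · simp [← hw, hw0]
      · exfalso
        obtain ⟨k, hk⟩ := exists_degree_eq hw0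
        rw [← hw, degree_mul, hf, hk] at hp
        norm_cast at hp
        omega
    · intro v
      obtain ⟨p, rfl⟩ := Submodule.mkQ_surjective _ v
      obtain ⟨r, hr, w, hw⟩ := exists_right_remainder f p d hf
      refine ⟨⟨r, hr⟩, ?_⟩
      change quotMk f r = quotMk f p
      rw [hw, map_add, quotMk_eq_zero.2 ⟨w, rfl⟩, zero_add]

/-- An element of degree less than `d` is given by its first `d` coefficients. -/
def degreeLTEquivFun (σ : K ≃+* K) (d : ℕ) : degreeLT σ d ≃ (Fin d → Twisted σ) :=
  Equiv.ofBijective (fun p i => p.1.coeff i) <| by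
    constructor
    · intro p q h
      refine Subtype.ext (SkewPolynomial.ext fun m => ?_)
      by_cases hm : m < d
      · exact congrFun h ⟨m, hm⟩
      · rw [(degree_lt_iff _ _).1 p.2 m (by omega), (degree_lt_iff _ _).1 q.2 m (by omega)]
    · intro c
      have hc : ∀ m, (∑ i : Fin d, SkewPolynomial.monomial (i : ℕ) (c i) : SkewPoly σ).coeff m =
          ∑ i : Fin d, if (i : ℕ) = m then c i else 0 := by
        intro m
        let g : SkewPoly σ →+ Twisted σ :=
          { toFun := fun p => p.coeff m
            map_zero' := SkewPolynomial.coeff_zero m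
            map_add' := fun p q => SkewPolynomial.coeff_add p q m }
        change g _ = _
        rw [map_sum]
        exact Finset.sum_congr rfl fun i _ => SkewPolynomial.coeff_monomial
      refine ⟨⟨∑ i : Fin d, SkewPolynomial.monomial (i : ℕ) (c i), ?_⟩, ?_⟩
      · refine (degree_lt_iff _ _).2 fun m hm => ?_
        rw [hc]
        exact Finset.sum_eq_zero fun i _ => if_neg (by omega)
      · funext i
        simp only [hc, Fin.val_inj]
        simp

theorem card_degreeLT (σ : K ≃+* K) (d : ℕ) : Nat.card (degreeLT σ d) = Nat.card K ^ d := by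
  rw [Nat.card_congr (degreeLTEquivFun σ d), Nat.card_fun, Nat.card_fin]
  rfl

instance [Finite K] (d : ℕ) : Finite (degreeLT σ d) := .of_equiv _ (degreeLTEquivFun σ d).symm

theorem card_quotMod {f : SkewPoly σ} (hf : degree f = d) :
    Nat.card (QuotMod f) = Nat.card K ^ d := by
  rw [← card_degreeLT σ d, Nat.card_congr (degreeLTEquiv hf).toEquiv]

theorem finite_quotMod [Finite K] {f : SkewPoly σ} (hf : degree f = d) :
    Finite (QuotMod f) := .of_equiv _ (degreeLTEquiv hf).toEquiv

/-! ### The semifields `𝕊_f` -/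

/-- A nonzero skew polynomial of degree less than `d` acts injectively on a simple module with
`|K| ^ d` elements. -/
theorem eq_zero_of_smul_eq_zero [Finite K] {V : Type v} [AddCommGroup V] [Module (SkewPoly σ) V]
    [IsSimpleModule (SkewPoly σ) V] (hV : Nat.card V = Nat.card K ^ d) {x : SkewPoly σ}
    (hx : degree x < d) {w : V} (hw : w ≠ 0) (h : x • w = 0) : x = 0 := by
  by_contra hx0
  obtain ⟨e, he⟩ := exists_degree_eq hx0
  rw [he] at hx
  -- By simplicity V = Rw, and since `x` kills `w` only remainders modulo `x` matter. So `V` has at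
  -- most `|K| ^ e` elements, too few because `e < d`.
  have hsurj : Function.Surjective fun r : degreeLT σ e => r.1 • w := by
    intro y
    obtain ⟨p, hp⟩ := IsSimpleModule.toSpanSingleton_surjective (SkewPoly σ) hw y
    obtain ⟨r, hr, u, hu⟩ := exists_right_remainder x p e he
    refine ⟨⟨r, hr⟩, ?_⟩
    change r • w = y
    rw [← hp, LinearMap.toSpanSingleton_apply, hu, add_smul, mul_smul, h, smul_zero, zero_add]
  have hle := Nat.card_le_card_of_surjective _ hsurj
  rw [card_degreeLT, hV] at hle
  have h1 : 1 < Nat.card K := Finite.one_lt_card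
  have := (Nat.pow_le_pow_iff_right h1).1 hle
  norm_cast at hx
  omega

/-- The additive identification of `𝕊_f` with `K[t;σ] / K[t;σ] f`. -/
def SfEquiv (f : IrrPoly σ d) : Sf f ≃+ QuotMod f.1 := degreeLTEquiv f.2.1

/-- Taking the remainder does not change the class modulo Rf. This turns questions about 𝕊_f into
questions about a module. -/
theorem SfEquiv_mul (f : IrrPoly σ d) (x y : Sf f) : SfEquiv f (x * y) = x.1 • SfEquiv f y := by
  change quotMk f.1 (modRight f (x.1 * y.1)) = x.1 • quotMk f.1 y.1
  obtain ⟨w, hw⟩ := modRight_spec f (x.1 * y.1)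
  rw [← map_smul, smul_eq_mul, ← sub_eq_zero, ← map_sub, quotMk_eq_zero]
  refine ⟨-w, ?_⟩
  rw [neg_mul, eq_sub_iff_add_eq]
  nth_rw 1 [hw]
  abel

theorem card_Sf (f : IrrPoly σ d) : Nat.card (Sf f) = Nat.card K ^ d := card_degreeLT σ d

theorem isFiniteSemifield_Sf [Finite K] (hd : 1 ≤ d) (f : IrrPoly σ d) :
    IsFiniteSemifield (Sf f) := by
  have hs := isSimpleModule_quotMod hd f.2.1 f.2.2
  have hval : ∀ x y : Sf f, (x + y).1 = x.1 + y.1 := fun _ _ => rfl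
  have hfin : Finite (Sf f) := inferInstanceAs (Finite (degreeLT σ d))
  refine ⟨hfin, ?_, ?_, ?_, ?_, ?_⟩
  · rw [← Finite.one_lt_card_iff_nontrivial, card_Sf]
    exact Nat.one_lt_pow (by omega) Finite.one_lt_card
  · intro x y z
    apply (SfEquiv f).injective
    simp only [SfEquiv_mul, map_add, smul_add]
  · intro x y z
    apply (SfEquiv f).injective
    simp only [SfEquiv_mul, map_add, hval, add_smul]
  · intro x y h
    by_cases hy : y = 0
    · exact Or.inr hy
    · refine Or.inl (Subtype.ext ?_)
      refine eq_zero_of_smul_eq_zero (card_quotMod f.2.1) x.2 (w := SfEquiv f y) ?_ ?_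
      · simpa using hy
      · rw [← SfEquiv_mul, h, map_zero]
  · have h1 : degree (1 : SkewPoly σ) < d := by
      have : degree (1 : SkewPoly σ) = 0 := degree_C one_ne_zero
      rw [this]; exact_mod_cast hd
    obtain ⟨e, he⟩ : ∃ e : Sf f, e.1 = 1 := ⟨(⟨1, h1⟩ : degreeLT σ d), rfl⟩
    refine ⟨e, fun x => ⟨?_, ?_⟩⟩
    · apply (SfEquiv f).injective
      rw [SfEquiv_mul, he, one_smul]
    · apply (SfEquiv f).injective
      rw [SfEquiv_mul]
      change x.1 • quotMk f.1 e.1 = quotMk f.1 x.1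
      rw [← map_smul, smul_eq_mul, he, mul_one]

/-- Similar irreducible elements give isotopic semifields. -/
theorem isotopic_of_linearEquiv (f g : IrrPoly σ d)
    (e : QuotMod f.1 ≃ₗ[SkewPoly σ] QuotMod g.1) : Isotopic (Sf f) (Sf g) := by
  let G : Sf f ≃+ Sf g := ((SfEquiv f).trans e.toAddEquiv).trans (SfEquiv g).symm
  have hG : ∀ x, SfEquiv g (G x) = e (SfEquiv f x) := fun x => by simp [G]
  -- The left factor acts as an element of R, which `e` respects, so it can stay fixed; only the
  -- right factor and the product are transported.
  refine ⟨AddEquiv.refl (degreeLT σ d), G, G, fun x y => ?_⟩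
  apply (SfEquiv g).injective
  rw [SfEquiv_mul, hG, hG, SfEquiv_mul, map_smul]
  rfl

end SkewRing

/-! ### Finite fields with an automorphism -/

section FiniteField

variable {F : Type u} {K : Type v} [Field F] [Field K] [Algebra F K]

/-- `σ` as an automorphism of `K` over a subfield that it fixes. -/
def autOfFixed (σ : K ≃+* K) (h : ∀ x : F, σ (algebraMap F K x) = algebraMap F K x) : Gal(K/F) :=
  AlgEquiv.ofRingEquiv h

theorem autOfFixed_pow_apply (σ : K ≃+* K) (h : ∀ x : F, σ (algebraMap F K x) = algebraMap F K x)
    (i : ℕ) (x : K) : (autOfFixed σ h ^ i) x = σ^[i] x := by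
  rw [AlgEquiv.coe_pow]; rfl

variable {σ : K ≃+* K}

theorem apply_algebraMap_of_fixed
    (hσ : ∀ x : K, σ x = x ↔ x ∈ Set.range (algebraMap F K)) (x : F) :
    σ (algebraMap F K x) = algebraMap F K x :=
  (hσ _).2 ⟨x, rfl⟩

variable [Finite K]

/-- The group generated by σ has fixed field F, so by the Galois correspondence it is the whole
Galois group. -/
theorem zpowers_autOfFixed
    (hσ : ∀ x : K, σ x = x ↔ x ∈ Set.range (algebraMap F K)) :
    Subgroup.zpowers (autOfFixed σ (apply_algebraMap_of_fixed hσ)) = ⊤ := by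
  set s := autOfFixed σ (apply_algebraMap_of_fixed hσ)
  have hbot : IntermediateField.fixedField (Subgroup.zpowers s) = ⊥ := by
    rw [eq_bot_iff]
    intro x hx
    rw [IntermediateField.mem_fixedField_iff] at hx
    exact IntermediateField.mem_bot.2 ((hσ x).1 (hx s (Subgroup.mem_zpowers s)))
  rw [← IntermediateField.fixingSubgroup_fixedField (Subgroup.zpowers s), hbot,
    IntermediateField.fixingSubgroup_bot]

variable [Finite F]

theorem orderOf_autOfFixed
    {q n : ℕ} (hσ : ∀ x : K, σ x = x ↔ x ∈ Set.range (algebraMap F K))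
    (hq : Nat.card F = q)
    (hn : Nat.card K = q ^ n) : orderOf (autOfFixed σ (apply_algebraMap_of_fixed hσ)) = n := by
  rw [← Nat.card_zpowers, zpowers_autOfFixed hσ, Nat.card_congr Subgroup.topEquiv.toEquiv,
    IsGalois.card_aut_eq_finrank]
  rw [Module.natCard_eq_pow_finrank (K := F), hq] at hn
  exact Nat.pow_right_injective (hq ▸ Finite.one_lt_card) hn

theorem iterate_eq_self_iff
    {q n : ℕ} (hσ : ∀ x : K, σ x = x ↔ x ∈ Set.range (algebraMap F K))
    (hq : Nat.card F = q)
    (hn : Nat.card K = q ^ n) (i : ℕ) : (∀ x, σ^[i] x = x) ↔ n ∣ i := by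
  rw [← orderOf_autOfFixed hσ hq hn, orderOf_dvd_iff_pow_eq_one, AlgEquiv.ext_iff]
  simp [autOfFixed_pow_apply]

/-- The powers of σ below n run once through the Galois group, so the product is the norm of `a`,
and norms of finite fields are surjective. It supplies the factor in t ↦ at that rescales t^n by a
given scalar. -/
theorem exists_prod_iterate_eq
    {q n : ℕ} (hσ : ∀ x : K, σ x = x ↔ x ∈ Set.range (algebraMap F K))
    (hq : Nat.card F = q)
    (hn : Nat.card K = q ^ n) (c : F) :
    ∃ a : K, ∏ i ∈ Finset.range n, σ^[i] a = algebraMap F K c := by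
  obtain ⟨a, ha⟩ := FiniteField.norm_surjective F K c
  refine ⟨a, ?_⟩
  set s := autOfFixed σ (apply_algebraMap_of_fixed hσ) 
  have hord := orderOf_autOfFixed hσ hq hn
  have hbij : Function.Bijective fun i : Fin n => s ^ (i : ℕ) := by
    have hinj : Function.Injective fun i : Fin n => s ^ (i : ℕ) := by
      intro i j hij
      exact Fin.ext (pow_injOn_Iio_orderOf (i.2.trans_eq hord.symm) (j.2.trans_eq hord.symm) hij)
    refine hinj.bijective_of_nat_card_le ?_
    rw [Nat.card_fin, ← Nat.card_congr (Subgroup.topEquiv (G := Gal(K/F))).toEquiv,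
      ← zpowers_autOfFixed hσ, Nat.card_zpowers, hord]
  rw [← ha, Algebra.norm_eq_prod_automorphisms, ← hbij.prod_comp, ← Fin.prod_univ_eq_prod_range]
  exact Finset.prod_congr rfl fun i _ => (autOfFixed_pow_apply σ _ i a).symm

/-- Every automorphism of a finite field extends to any finite extension, as a power of the
Frobenius automorphism, and hence so that it commutes with all automorphisms. -/
theorem exists_extension_commuting (ρ : F ≃+* F) (σ : K ≃+* K) :
    ∃ τ : K ≃+* K, (∀ x, τ (algebraMap F K x) = algebraMap F K (ρ x)) ∧
      ∀ x, τ (σ x) = σ (τ x) := by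
  obtain ⟨p, hp⟩ := CharP.exists F
  have hpp : Fact p.Prime := ⟨(CharP.char_is_prime_or_zero F p).resolve_right
    (CharP.char_ne_zero_of_finite F p)⟩
  have : CharP K p := charP_of_injective_algebraMap (algebraMap F K).injective p
  let _ : Algebra (ZMod p) F := ZMod.algebra F p
  let ρ' : Gal(F/ZMod p) := AlgEquiv.ofRingEquiv (f := ρ) fun x => by
    exact DFunLike.congr_fun (Subsingleton.elim ((ρ : F →+* F).comp (algebraMap (ZMod p) F))
      (algebraMap (ZMod p) F)) x
  obtain ⟨i, hi⟩ := (FiniteField.bijective_frobeniusAlgEquivOfAlgebraic_pow (ZMod p) F).2 ρ'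
  have hρ : ∀ x, ρ x = x ^ p ^ (i : ℕ) := by
    intro x
    change ρ' x = _
    rw [← hi]
    simp [AlgEquiv.coe_pow, FiniteField.coe_frobeniusAlgEquivOfAlgebraic, pow_iterate, ZMod.card]
  refine ⟨iterateFrobeniusEquiv K p i, fun x => ?_, fun x => ?_⟩
  · rw [iterateFrobeniusEquiv_def, hρ, map_pow]
  · rw [iterateFrobeniusEquiv_def, iterateFrobeniusEquiv_def, map_pow]

end FiniteField

/-! ### Central skew polynomials -/

section Central

variable {F : Type u} {K : Type v} [Field F] [Field K] [Algebra F K] {σ : K ≃+* K}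

/-- The constants of `F` in the tagged copy of `K`. -/
def toTw (F : Type u) [Field F] [Algebra F K] (σ : K ≃+* K) : F →+* Twisted σ :=
  (toTwisted σ : K →+* Twisted σ).comp (algebraMap F K)

theorem toTw_injective : Function.Injective (toTw F σ) := (toTw F σ).injective

theorem iterate_phi_apply (i : ℕ) (a : Twisted σ) :
    (SkewPolynomial.φ)^[i] a = toTwisted σ (σ^[i] ((toTwisted σ).symm a)) := by
  induction i generalizing a with
  | zero => simp
  | succ i ih =>
    rw [Function.iterate_succ_apply, Function.iterate_succ_apply, ih]
    rfl

variable (hF : ∀ x : F, σ (algebraMap F K x) = algebraMap F K x)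

theorem phi_toTw
    (hF : ∀ x : F, σ (algebraMap F K x) = algebraMap F K x) (c : F) :
    (SkewPolynomial.φ : Twisted σ →+* Twisted σ) (toTw F σ c) =
    toTw F σ c := by
  change SkewPolynomial.φ (toTwisted σ (algebraMap F K c)) = _
  rw [phi_apply, hF]
  rfl

theorem iterate_phi_toTw
    (hF : ∀ x : F, σ (algebraMap F K x) = algebraMap F K x) (c : F) (i : ℕ) :
    (SkewPolynomial.φ)^[i] (toTw F σ c) = toTw F σ c :=
  Function.iterate_fixed (phi_toTw hF c) i

/-- The ring homomorphism `F[y] → K[t;σ]`, `p ↦ p(t ^ n)`, for `F` fixed by `σ`. -/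
def centralHom (n : ℕ) (hF : ∀ x : F, σ (algebraMap F K x) = algebraMap F K x) :
    F[X] →+* SkewPoly σ :=
  Polynomial.eval₂RingHom' (SkewPolynomial.CRingHom.comp (toTw F σ)) (SkewPolynomial.X ^ n) <| by
    intro c
    change SkewPolynomial.C (toTw F σ c) * SkewPolynomial.X ^ n =
      SkewPolynomial.X ^ n * SkewPolynomial.C (toTw F σ c)
    rw [SkewPolynomial.C_mul_X_pow_eq_monomial, ← SkewPolynomial.monomial_one_right_eq_X_pow,
      SkewPolynomial.monomial_mul_C, iterate_phi_toTw hF, one_mul]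

theorem centralHom_C (n : ℕ) (c : F) :
    centralHom n hF (Polynomial.C c) = SkewPolynomial.C (toTw F σ c) :=
  Polynomial.eval₂_C _ _

theorem centralHom_X (n : ℕ) : centralHom n hF Polynomial.X = SkewPolynomial.X ^ n :=
  Polynomial.eval₂_X _ _

theorem centralHom_C_mul_X_pow (n i : ℕ) (c : F) :
    centralHom n hF (Polynomial.C c * Polynomial.X ^ i) =
      SkewPolynomial.monomial (n * i) (toTw F σ c) := by
  rw [map_mul, map_pow, centralHom_C, centralHom_X, ← pow_mul,
    SkewPolynomial.C_mul_X_pow_eq_monomial]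

theorem coeff_centralHom_mul {n : ℕ} (hn : n ≠ 0) (p : F[X]) (i : ℕ) :
    (centralHom n hF p).coeff (n * i) = toTw F σ (p.coeff i) := by
  induction p using Polynomial.induction_on' with
  | add p q hp hq => rw [map_add, SkewPolynomial.coeff_add, hp, hq, Polynomial.coeff_add, map_add]
  | monomial j c =>
    rw [← Polynomial.C_mul_X_pow_eq_monomial, centralHom_C_mul_X_pow, SkewPolynomial.coeff_monomial,
      Polynomial.coeff_C_mul_X_pow]
    by_cases h : i = j
    · simp [h]
    · rw [if_neg h, if_neg (by simpa [hn] using Ne.symm h), map_zero]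

theorem coeff_centralHom_of_not_dvd {n : ℕ} (p : F[X]) {m : ℕ} (hm : ¬ n ∣ m) :
    (centralHom n hF p).coeff m = 0 := by
  induction p using Polynomial.induction_on' with
  | add p q hp hq => rw [map_add, SkewPolynomial.coeff_add, hp, hq, add_zero]
  | monomial j c =>
    rw [← Polynomial.C_mul_X_pow_eq_monomial, centralHom_C_mul_X_pow, SkewPolynomial.coeff_monomial,
      if_neg]
    rintro rfl
    exact hm ⟨j, rfl⟩

theorem centralHom_injective {n : ℕ} (hn : n ≠ 0) : Function.Injective (centralHom n hF) := by
  intro p q h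
  ext i
  apply toTw_injective (K := K) (σ := σ)
  rw [← coeff_centralHom_mul hF hn, h, coeff_centralHom_mul hF hn]

theorem degree_centralHom {n : ℕ} (hn : n ≠ 0) {p : F[X]} (hp : p ≠ 0) :
    degree (centralHom n hF p) = ((n * p.natDegree : ℕ) : WithBot ℕ) := by
  rw [degree_eq_iff, coeff_centralHom_mul hF hn]
  refine ⟨?_, fun m hm => ?_⟩
  · rw [map_ne_zero]
    exact Polynomial.leadingCoeff_ne_zero.2 hp
  · by_cases hd : n ∣ m
    · obtain ⟨i, rfl⟩ := hd
      rw [coeff_centralHom_mul hF hn, Polynomial.coeff_eq_zero_of_natDegree_lt, map_zero]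
      exact lt_of_mul_lt_mul_left hm (Nat.zero_le n)
    · exact coeff_centralHom_of_not_dvd hF p hd

/-- t^n commutes with K because σ^n = 1, and constants from F commute with t because σ fixes them.
-/
theorem commute_centralHom {n : ℕ} (hn : ∀ x, σ^[n] x = x) (p : F[X]) (r : SkewPoly σ) :
    r * centralHom n hF p = centralHom n hF p * r := by
  have hphi : ∀ (i : ℕ) (a : Twisted σ), (SkewPolynomial.φ)^[n * i] a = a := by
    intro i a
    rw [iterate_phi_apply, Function.iterate_mul, Function.iterate_fixed (hn _)]
    simp
  induction p using Polynomial.induction_on' with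
  | add p q hp hq => rw [map_add, mul_add, hp, hq, add_mul]
  | monomial j c =>
    rw [← Polynomial.C_mul_X_pow_eq_monomial, centralHom_C_mul_X_pow]
    induction r using SkewPolynomial.induction with
    | h0 => simp
    | ha i s r hi hs ih =>
      rw [mul_add, add_mul, ih, SkewPolynomial.monomial_mul_monomial,
        SkewPolynomial.monomial_mul_monomial, iterate_phi_toTw hF, hphi, add_comm i, mul_comm s]

/-- A skew polynomial in `t ^ n` with coefficients fixed by `σ` is of the form `p(t ^ n)`. -/
theorem exists_centralHom_eq {n : ℕ} (hn0 : n ≠ 0)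
    (hσ : ∀ x : K, σ x = x ↔ x ∈ Set.range (algebraMap F K)) {r : SkewPoly σ}
    (h1 : ∀ i, r.coeff i ≠ 0 → n ∣ i) (h2 : ∀ i, SkewPolynomial.φ (r.coeff i) = r.coeff i) :
    ∃ p : F[X], centralHom n hF p = r := by
  have h3 : ∀ i, ∃ c, toTw F σ c = r.coeff i := fun i => (hσ _).1 <| by
    have := h2 i
    rw [← (toTwisted σ).apply_symm_apply (r.coeff i), phi_apply] at this
    exact (toTwisted σ).injective this
  choose c hc using h3
  obtain ⟨k, hk⟩ : ∃ k, degree r < (k : ℕ) := by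
    by_cases h : r = 0
    · exact ⟨0, by rw [h, degree_zero]; exact WithBot.bot_lt_coe 0⟩
    · obtain ⟨k, hk⟩ := exists_degree_eq h
      exact ⟨k + 1, by rw [hk]; exact_mod_cast Nat.lt_succ_self k⟩
  rw [degree_lt_iff] at hk
  -- `k` bounds the degree in t; it is long enough for the exponents of t^n too, since `k ≤ i` gives
  -- `k ≤ n * i`.
  refine ⟨∑ i ∈ Finset.range k, Polynomial.C (c (n * i)) * Polynomial.X ^ i, ?_⟩
  ext m
  by_cases hd : n ∣ m
  · obtain ⟨i, rfl⟩ := hd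
    rw [coeff_centralHom_mul hF hn0, Polynomial.finsetSum_coeff]
    simp only [Polynomial.coeff_C_mul_X_pow, Finset.sum_ite_eq, Finset.mem_range]
    split_ifs with h
    · exact hc _
    · rw [map_zero, hk]
      exact (not_lt.1 h).trans (Nat.le_mul_of_pos_left i (Nat.pos_of_ne_zero hn0))
  · rw [coeff_centralHom_of_not_dvd hF _ hd]
    by_contra h
    exact hd (h1 m (Ne.symm h))

end Central

/-! ### Annihilators of finite simple modules -/

section Annihilator

variable {K : Type v} [Field K] {σ : K ≃+* K} {V : Type w} [AddCommGroup V] [Module (SkewPoly σ) V]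

/-- V = Rw, and moving z past p gives zpw = p'zw = 0. -/
theorem smul_eq_zero_of_normal [IsSimpleModule (SkewPoly σ) V] {z : SkewPoly σ}
    (hz : ∀ p, ∃ p', z * p = p' * z) {w : V} (hw : w ≠ 0) (h : z • w = 0) (y : V) :
    z • y = 0 := by
  obtain ⟨p, rfl⟩ := IsSimpleModule.toSpanSingleton_surjective (SkewPoly σ) hw y
  obtain ⟨p', hp'⟩ := hz p
  rw [LinearMap.toSpanSingleton_apply, ← mul_smul, hp', mul_smul, h, smul_zero]

/-- An element normalizing the ring acts on a finite simple module either as zero or bijectively. -/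
theorem smul_surjective_of_normal [Finite V] [IsSimpleModule (SkewPoly σ) V] {z : SkewPoly σ}
    (hz : ∀ p, ∃ p', z * p = p' * z) (h : ∃ v : V, z • v ≠ 0) :
    Function.Surjective fun v : V => z • v := by
  refine Finite.surjective_of_injective ?_
  intro v w hvw
  by_contra hne
  obtain ⟨y, hy⟩ := h
  refine hy (smul_eq_zero_of_normal hz (sub_ne_zero.2 hne) ?_ y)
  rw [smul_sub]
  exact sub_eq_zero.2 hvw

theorem X_normal (p : SkewPoly σ) :
    ∃ p', (SkewPolynomial.X : SkewPoly σ) * p = p' * SkewPolynomial.X :=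
  ⟨_, SkewPolynomial.X_mul⟩

variable (V) in
/-- `r` is monic of degree `k`, and of minimal degree among the annihilators of `V`. -/
structure IsMinimalAnnihilator (r : SkewPoly σ) (k : ℕ) : Prop where
  degree_eq : degree r = k
  coeff_eq_one : r.coeff k = 1
  smul_eq_zero : ∀ v : V, r • v = 0
  eq_zero : ∀ s : SkewPoly σ, degree s < (k : WithBot ℕ) → (∀ v : V, s • v = 0) → s = 0

/-- Pigeonhole: V has finitely many self-maps, so two distinct powers of t act identically. -/
theorem exists_annihilator [Finite V] : ∃ r : SkewPoly σ, r ≠ 0 ∧ ∀ v : V, r • v = 0 := by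
  obtain ⟨i, j, hij, h⟩ := Finite.exists_ne_map_eq_of_infinite
    fun (i : ℕ) (v : V) => (SkewPolynomial.monomial i 1 : SkewPoly σ) • v
  refine ⟨SkewPolynomial.monomial i 1 - SkewPolynomial.monomial j 1, fun h0 => ?_, fun v => ?_⟩
  · have := congrArg (fun p : SkewPoly σ => p.coeff i) h0
    simp [SkewPolynomial.coeff_sub, SkewPolynomial.coeff_monomial, hij.symm] at this
  · rw [sub_smul, sub_eq_zero]
    exact congrFun h v

variable (σ V) in
theorem exists_isMinimalAnnihilator [Finite V] :
    ∃ (r : SkewPoly σ) (k : ℕ), IsMinimalAnnihilator V r k := by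
  classical
  have hex : ∃ k : ℕ, ∃ r : SkewPoly σ, degree r = k ∧ ∀ v : V, r • v = 0 := by
    obtain ⟨r, hr0, hr⟩ := exists_annihilator (σ := σ) (V := V)
    obtain ⟨k, hk⟩ := exists_degree_eq hr0
    exact ⟨k, r, hk, hr⟩
  obtain ⟨r, hk, hr⟩ := Nat.find_spec hex
  have hc := coeff_ne_zero_of_degree_eq hk
  refine ⟨SkewPolynomial.C (r.coeff (Nat.find hex))⁻¹ * r, Nat.find hex, ?_, ?_, ?_, ?_⟩
  · rw [degree_mul, degree_C (inv_ne_zero hc), hk, zero_add]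
  · rw [coeff_C_mul, inv_mul_cancel₀ hc]
  · intro v
    rw [mul_smul, hr, smul_zero]
  · intro s hs h
    by_contra hs0
    obtain ⟨j, hj⟩ := exists_degree_eq hs0
    rw [hj] at hs
    exact Nat.find_min hex (by exact_mod_cast hs) ⟨s, hj, h⟩

namespace IsMinimalAnnihilator

variable {r : SkewPoly σ} {k : ℕ}

theorem eq_mul (hr : IsMinimalAnnihilator V r k) {s : SkewPoly σ} (hs : ∀ v : V, s • v = 0) :
    ∃ w, w * r = s := by
  obtain ⟨s', hs', w, hw⟩ := exists_right_remainder r s k hr.degree_eq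
  refine ⟨w, ?_⟩
  rw [hw, hr.eq_zero s' hs' fun v => ?_, add_zero]
  have := hs v
  rwa [hw, add_smul, mul_smul, hr.smul_eq_zero, smul_zero, zero_add] at this

variable [Finite V] [IsSimpleModule (SkewPoly σ) V]

/-- Otherwise r = wt. As t acts surjectively, w would annihilate V as well, with smaller degree. -/
theorem coeff_zero_ne_zero (hr : IsMinimalAnnihilator V r k)
    (hX : ∃ v : V, (SkewPolynomial.X : SkewPoly σ) • v ≠ 0) :
    r.coeff 0 ≠ 0 := by
  intro h0
  have hXdeg : degree (SkewPolynomial.X : SkewPoly σ) = (1 : ℕ) := degree_eq_iff.2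
    ⟨by simp, fun m hm => SkewPolynomial.coeff_X_of_ne_one (by omega)⟩
  obtain ⟨s, hs, w, hw⟩ := exists_right_remainder SkewPolynomial.X r 1 hXdeg
  have hs0 : s = 0 := by
    rw [eq_C_of_degree_lt_one hs]
    have := congrArg (fun p : SkewPoly σ => p.coeff 0) hw
    simp only [SkewPolynomial.coeff_add, coeff_mul_X_zero, zero_add] at this
    rw [← this, h0, map_zero]
  rw [hs0, add_zero] at hw
  have hr0 : r ≠ 0 := by
    intro h
    have := hr.degree_eq
    rw [h, degree_zero] at this
    exact absurd this (by simp)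
  have hw0 : w ≠ 0 := by rintro rfl; exact hr0 (by simp [hw])
  obtain ⟨j, hj⟩ := exists_degree_eq hw0
  have hdeg := hr.degree_eq
  rw [hw, degree_mul, hXdeg, hj] at hdeg
  norm_cast at hdeg
  refine hw0 (hr.eq_zero w ?_ fun v => ?_)
  · rw [hj]; exact_mod_cast (by omega)
  · obtain ⟨v, rfl⟩ := smul_surjective_of_normal X_normal hX v
    change w • (SkewPolynomial.X : SkewPoly σ) • v = 0
    rw [← mul_smul, ← hw, hr.smul_eq_zero]

/-- An annihilator of degree at most k is a constant times r, and the constant term of r is nonzero.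
This gains one degree over minimality, which the commutator with t needs. -/
theorem eq_zero_of_coeff_zero (hr : IsMinimalAnnihilator V r k)
    (hX : ∃ v : V, (SkewPolynomial.X : SkewPoly σ) • v ≠ 0)
    {s : SkewPoly σ} (hs : degree s < ((k + 1 : ℕ) : WithBot ℕ))
    (h0 : s.coeff 0 = 0) (h : ∀ v : V, s • v = 0) : s = 0 := by
  rw [degree_lt_iff] at hs
  have h1 : s - SkewPolynomial.C (s.coeff k) * r = 0 := by
    refine hr.eq_zero _ ((degree_lt_iff _ _).2 fun m hm => ?_) fun v => ?_
    · rw [SkewPolynomial.coeff_sub, coeff_C_mul]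
      rcases hm.eq_or_lt with rfl | hm
      · rw [hr.coeff_eq_one, mul_one, sub_self]
      · rw [hs m hm, (degree_eq_iff.1 hr.degree_eq).2 m hm, mul_zero, sub_zero]
    · rw [sub_smul, h, mul_smul, hr.smul_eq_zero, smul_zero, sub_zero]
  have h2 := congrArg (fun p : SkewPoly σ => p.coeff 0) h1
  simp only [SkewPolynomial.coeff_sub, coeff_C_mul, h0, zero_sub, SkewPolynomial.coeff_zero,
    neg_eq_zero, mul_eq_zero, hr.coeff_zero_ne_zero hX, or_false] at h2
  rw [h2, map_zero, zero_mul, sub_zero] at h1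
  exact h1

/-- An element of degree at most `k` commuting with the indeterminate up to annihilators has
coefficients fixed by `σ`. -/
theorem phi_coeff_eq (hr : IsMinimalAnnihilator V r k)
    (hX : ∃ v : V, (SkewPolynomial.X : SkewPoly σ) • v ≠ 0)
    {s : SkewPoly σ} (hs : degree s < ((k + 1 : ℕ) : WithBot ℕ))
    (hsk : SkewPolynomial.φ (s.coeff k) = s.coeff k)
    (h : ∀ v : V, (SkewPolynomial.X * s - s * SkewPolynomial.X) • v = 0) (i : ℕ) :
    SkewPolynomial.φ (s.coeff i) = s.coeff i := by
  -- The commutator could have degree k + 1, but `hsk` cancels that coefficient; its constant term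
  -- vanishes automatically.
  have h0 : SkewPolynomial.X * s - s * SkewPolynomial.X = 0 := by
    refine hr.eq_zero_of_coeff_zero hX ((degree_lt_iff _ _).2 fun m hm => ?_) ?_ h
    · obtain ⟨m, rfl⟩ : ∃ j, m = j + 1 := ⟨m - 1, by omega⟩
      rw [SkewPolynomial.coeff_sub, coeff_X_mul, coeff_mul_X]
      rcases (show k ≤ m by omega).eq_or_lt with rfl | hm
      · rw [hsk, sub_self]
      · rw [(degree_lt_iff _ _).1 hs m hm, map_zero, sub_zero]
    · rw [SkewPolynomial.coeff_sub, coeff_X_mul_zero, coeff_mul_X_zero, sub_zero]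
  have := congrArg (fun p : SkewPoly σ => p.coeff (i + 1)) h0
  simp only [SkewPolynomial.coeff_sub, coeff_X_mul, coeff_mul_X, SkewPolynomial.coeff_zero] at this
  exact sub_eq_zero.1 this

theorem phi_coeff_self (hr : IsMinimalAnnihilator V r k)
    (hX : ∃ v : V, (SkewPolynomial.X : SkewPoly σ) • v ≠ 0)
    (i : ℕ) : SkewPolynomial.φ (r.coeff i) = r.coeff i := by
  refine hr.phi_coeff_eq hX ?_ ?_ (fun v => ?_) i
  · rw [hr.degree_eq]; exact_mod_cast Nat.lt_succ_self k
  · rw [hr.coeff_eq_one, map_one]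
  · rw [sub_smul, mul_smul, mul_smul, hr.smul_eq_zero, hr.smul_eq_zero, smul_zero, sub_zero]

theorem iterate_phi_eq_self (hr : IsMinimalAnnihilator V r k)
    (hX : ∃ v : V, (SkewPolynomial.X : SkewPoly σ) • v ≠ 0)
    {i : ℕ} (hi : r.coeff i ≠ 0) (a : Twisted σ) :
    (SkewPolynomial.φ)^[i] a = a := by
  -- The twist by `φ^[k]` cancels the leading terms, so minimality applies. Comparing coefficients,
  -- all exponents in the support of r act alike on `a`, and 0 is one of them.
  have h0 : r * SkewPolynomial.C a - SkewPolynomial.C ((SkewPolynomial.φ)^[k] a) * r = 0 := by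
    refine hr.eq_zero _ ((degree_lt_iff _ _).2 fun m hm => ?_) fun v => ?_
    · rw [SkewPolynomial.coeff_sub, coeff_C_mul, coeff_mul_C]
      rcases hm.eq_or_lt with rfl | hm
      · rw [hr.coeff_eq_one, mul_one, one_mul, sub_self]
      · rw [(degree_eq_iff.1 hr.degree_eq).2 m hm, mul_zero, zero_mul, sub_zero]
    · rw [sub_smul, mul_smul, mul_smul, hr.smul_eq_zero, hr.smul_eq_zero, smul_zero, sub_zero]
  have hc : ∀ j, r.coeff j ≠ 0 → (SkewPolynomial.φ)^[j] a = (SkewPolynomial.φ)^[k] a := by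
    intro j hj
    have := congrArg (fun p : SkewPoly σ => p.coeff j) h0
    simp only [SkewPolynomial.coeff_sub, coeff_C_mul, coeff_mul_C, SkewPolynomial.coeff_zero] at this
    rw [sub_eq_zero, mul_comm] at this
    exact mul_right_cancel₀ hj this
  rw [hc i hi, ← hc 0 (hr.coeff_zero_ne_zero hX)]
  rfl

end IsMinimalAnnihilator

end Annihilator

/-! ### The annihilator as an irreducible polynomial in t^n -/

section AnnihilatorPolynomial

variable {F : Type u} {K : Type v} [Field F] [Field K] [Algebra F K] {σ : K ≃+* K}
  {V : Type w} [AddCommGroup V] [Module (SkewPoly σ) V] [Finite V] [IsSimpleModule (SkewPoly σ) V]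
  {n : ℕ}

theorem dvd_of_iterate_phi (hn : ∀ i, (∀ x, σ^[i] x = x) ↔ n ∣ i) {i : ℕ}
    (h : ∀ a : Twisted σ, (SkewPolynomial.φ)^[i] a = a) : n ∣ i := by
  refine (hn i).1 fun x => ?_
  have := h (toTwisted σ x)
  rw [iterate_phi_apply, RingEquiv.symm_apply_apply] at this
  exact (toTwisted σ).injective this

/-- The annihilator of a finite simple module on which `t` does not act as zero is generated by
`P(t ^ n)` for a monic irreducible polynomial `P` over the fixed field. -/
theorem exists_annihilator_polynomial (hn0 : n ≠ 0)
    (hσ : ∀ x : K, σ x = x ↔ x ∈ Set.range (algebraMap F K))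
    (hn : ∀ i, (∀ x, σ^[i] x = x) ↔ n ∣ i)
    (hX : ∃ v : V, (SkewPolynomial.X : SkewPoly σ) • v ≠ 0) :
    ∃ P : F[X], P.Monic ∧ Irreducible P ∧ IsMinimalAnnihilator V
      (centralHom n (apply_algebraMap_of_fixed hσ) P) (n * P.natDegree) := by
  obtain ⟨r, k, hr⟩ := exists_isMinimalAnnihilator σ V
  set hF := apply_algebraMap_of_fixed hσ
  obtain ⟨P, rfl⟩ := exists_centralHom_eq hF hn0 hσ
    (fun i hi => dvd_of_iterate_phi hn (hr.iterate_phi_eq_self hX hi)) (hr.phi_coeff_self hX)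
  have hP0 : P ≠ 0 := by
    rintro rfl
    have := hr.degree_eq
    rw [map_zero, degree_zero] at this
    exact absurd this (by simp)
  have hk : k = n * P.natDegree := by
    have := hr.degree_eq
    rw [degree_centralHom hF hn0 hP0] at this
    exact_mod_cast this.symm
  subst hk
  have hmonic : P.Monic := by
    have := hr.coeff_eq_one
    rw [coeff_centralHom_mul hF hn0] at this
    exact toTw_injective (this.trans (map_one _).symm)
  refine ⟨P, hmonic, ?_, hr⟩
  have hcomm := fun p q => commute_centralHom hF ((hn n).2 dvd_rfl) p q
  have hle : ∀ B : F[X], B ≠ 0 → (∀ v : V, centralHom n hF B • v = 0) →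
      P.natDegree ≤ B.natDegree := by
    intro B hB h
    by_contra hlt
    refine hB (centralHom_injective hF hn0 ((hr.eq_zero _ ?_ h).trans (map_zero _).symm))
    rw [degree_centralHom hF hn0 hB]
    exact_mod_cast Nat.mul_lt_mul_of_pos_left (not_le.1 hlt) (Nat.pos_of_ne_zero hn0)
  refine ⟨fun hu => ?_, fun A B hAB => ?_⟩
  · obtain ⟨v, hv⟩ := hX
    have hP1 : P = 1 := hmonic.eq_one_of_isUnit hu
    have := hr.smul_eq_zero ((SkewPolynomial.X : SkewPoly σ) • v)
    rw [hP1, map_one, one_smul] at this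
    exact hv this
  · have hA : A ≠ 0 := by rintro rfl; simp [hP0] at hAB
    have hB : B ≠ 0 := by rintro rfl; simp [hP0] at hAB
    have hd : P.natDegree = A.natDegree + B.natDegree := by
      rw [hAB, Polynomial.natDegree_mul hA hB]
    have hunit : ∀ C : F[X], C ≠ 0 → C.natDegree = 0 → IsUnit C := by
      intro C hC h
      rw [Polynomial.isUnit_iff_degree_eq_zero, Polynomial.degree_eq_natDegree hC, h]
      rfl
    -- B(t^n) is central, so it acts as zero or bijectively. In the first case minimality makes A
    -- constant; in the second A(t^n) annihilates V and B is constant.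
    by_cases hBv : ∀ v : V, centralHom n hF B • v = 0
    · have := hle B hB hBv
      exact Or.inl (hunit A hA (by omega))
    · push Not at hBv
      refine Or.inr (hunit B hB ?_)
      have := hle A hA fun v => by
        obtain ⟨v, rfl⟩ := smul_surjective_of_normal
          (fun p => ⟨p, (hcomm B p).symm⟩) hBv v
        change _ • _ • v = 0
        rw [← mul_smul, ← map_mul, ← hAB, hr.smul_eq_zero]
      omega

end AnnihilatorPolynomial

/-! ### Endomorphism rings and the degree of the annihilating polynomial -/

section Dimension

variable {F : Type u} {K : Type v} [Field F] [Field K] [Algebra F K]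
  {σ : K ≃+* K} {V : Type w} [AddCommGroup V] [Module (SkewPoly σ) V] {q n d : ℕ}

theorem exists_degree_lt_smul_eq {r : SkewPoly σ} {k : ℕ} (hr : IsMinimalAnnihilator V r k)
    (s : SkewPoly σ) : ∃ s' : SkewPoly σ, degree s' < k ∧ ∀ v : V, s • v = s' • v := by
  obtain ⟨s', hs', w, hw⟩ := exists_right_remainder r s k hr.degree_eq
  refine ⟨s', hs', fun v => ?_⟩
  rw [hw, add_smul, mul_smul, hr.smul_eq_zero, smul_zero, zero_add]

variable [Finite V] [IsSimpleModule (SkewPoly σ) V]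

instance : Finite (Module.End (SkewPoly σ) V) :=
  Finite.of_injective (fun f => (f : V → V)) DFunLike.coe_injective

/-- Schur's lemma makes the endomorphism ring a division ring; being finite, it is a field by
Wedderburn. -/
theorem moduleEnd_apply_comm (f g : Module.End (SkewPoly σ) V) (v : V) : f (g v) = g (f v) := by
  classical
  exact LinearMap.congr_fun
    ((Finite.isDomain_to_isField (Module.End (SkewPoly σ) V)).mul_comm f g) v

/-- By Jacobson density, the ring acts on `V` through all endomorphisms of `V` over its
endomorphism ring. -/
theorem card_end_moduleEnd {r : SkewPoly σ} {k : ℕ} (hr : IsMinimalAnnihilator V r k) :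
    Nat.card (V →ₗ[Module.End (SkewPoly σ) V] V) = Nat.card K ^ k := by
  classical
  rw [← card_degreeLT σ k]
  let T := Module.toModuleEnd (Module.End (SkewPoly σ) V) (S := SkewPoly σ) V
  have hT : ∀ p v, T p v = p • v := fun _ _ => rfl
  refine (Nat.card_congr (Equiv.ofBijective (fun p : degreeLT σ k => T p.1) ⟨?_, ?_⟩)).symm
  · intro p p' h
    refine Subtype.ext (sub_eq_zero.1 (hr.eq_zero _ ((degreeLT σ k).sub_mem p.2 p'.2) fun v => ?_))
    have := LinearMap.congr_fun h v
    simp only [hT] at this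
    rw [sub_smul, this, sub_self]
  · intro f
    obtain ⟨p, hp⟩ := Module.Finite.toModuleEnd_moduleEnd_surjective (R := SkewPoly σ) (M := V) f
    obtain ⟨p', hp', h⟩ := exists_degree_lt_smul_eq hr p
    refine ⟨⟨p', hp'⟩, LinearMap.ext fun v => ?_⟩
    change p' • v = f v
    rw [← h, ← hp]
    rfl

/-- The endomorphisms of `V` are given by the central elements `p(t ^ n)`. -/
theorem card_moduleEnd (hn0 : n ≠ 0)
    (hσ : ∀ x : K, σ x = x ↔ x ∈ Set.range (algebraMap F K))
    (hn : ∀ i, (∀ x, σ^[i] x = x) ↔ n ∣ i)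
    (hX : ∃ v : V, (SkewPolynomial.X : SkewPoly σ) • v ≠ 0) {P : F[X]}
    (hP : IsMinimalAnnihilator V
      (centralHom n (apply_algebraMap_of_fixed hσ) P) (n * P.natDegree)) :
    Nat.card (Module.End (SkewPoly σ) V) = Nat.card F ^ P.natDegree := by
  classical
  set hF := apply_algebraMap_of_fixed hσ
  have hcomm := fun p q => commute_centralHom hF ((hn n).2 dvd_rfl) p q
  let E : F[X] → Module.End (SkewPoly σ) V := fun p =>
    { toFun := fun v => centralHom n hF p • v
      map_add' := smul_add _
      map_smul' := fun r v => by
        rw [← mul_smul, ← hcomm, mul_smul]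
        rfl }
  have hE : ∀ p v, E p v = centralHom n hF p • v := fun _ _ => rfl
  have hcard : Nat.card (Polynomial.degreeLT F P.natDegree) = Nat.card F ^ P.natDegree := by
    rw [Nat.card_congr (Polynomial.degreeLTEquiv F P.natDegree).toEquiv, Nat.card_fun,
      Nat.card_fin]
  rw [← hcard]
  refine (Nat.card_congr (Equiv.ofBijective
    (fun p : Polynomial.degreeLT F P.natDegree => E p.1) ⟨?_, ?_⟩)).symm
  · intro p p' h
    have hmem : p.1 - p'.1 ∈ Polynomial.degreeLT F P.natDegree :=
      (Polynomial.degreeLT F P.natDegree).sub_mem p.2 p'.2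
    rw [Polynomial.mem_degreeLT] at hmem
    refine Subtype.ext (sub_eq_zero.1 ?_)
    by_contra hne
    refine hne (centralHom_injective hF hn0
      ((hP.eq_zero _ ?_ fun v => ?_).trans (map_zero _).symm))
    · rw [degree_centralHom hF hn0 hne]
      rw [Polynomial.degree_eq_natDegree hne] at hmem
      norm_cast at hmem ⊢
      exact Nat.mul_lt_mul_of_pos_left hmem (Nat.pos_of_ne_zero hn0)
    · have := LinearMap.congr_fun h v
      simp only [hE] at this
      rw [map_sub, sub_smul, this, sub_self]
  · intro f
    -- Since the endomorphism ring is commutative, `f` is linear over it, and density realizes `f`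
    -- as the action of an element of R.
    let f' : V →ₗ[Module.End (SkewPoly σ) V] V :=
      { toFun := f
        map_add' := map_add f
        map_smul' := fun g v => moduleEnd_apply_comm f g v }
    obtain ⟨s, hs⟩ := Module.Finite.toModuleEnd_moduleEnd_surjective (R := SkewPoly σ) (M := V) f'
    obtain ⟨r, hr, h⟩ := exists_degree_lt_smul_eq hP s
    have hrf : ∀ v, r • v = f v := by
      intro v
      rw [← h]
      exact LinearMap.congr_fun hs v
    have hr' := (degree_lt_iff _ _).1 hr
    -- `r` acts as an endomorphism, so its commutators with K and with t annihilate V. By minimality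
    -- they vanish, and `r` is a polynomial in t^n over F.
    have hdvd : ∀ i, r.coeff i ≠ 0 → n ∣ i := by
      refine fun i hi => dvd_of_iterate_phi hn fun a => ?_
      have h0 : r * SkewPolynomial.C a - SkewPolynomial.C a * r = 0 := by
        refine hP.eq_zero _ ((degree_lt_iff _ _).2 fun m hm => ?_) fun v => ?_
        · rw [SkewPolynomial.coeff_sub, coeff_C_mul, coeff_mul_C, hr' m hm, zero_mul, mul_zero,
            sub_zero]
        · rw [sub_smul, mul_smul, mul_smul, hrf, hrf, map_smul, sub_self]
      have := congrArg (fun p : SkewPoly σ => p.coeff i) h0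
      simp only [SkewPolynomial.coeff_sub, coeff_C_mul, coeff_mul_C,
        SkewPolynomial.coeff_zero] at this
      rw [sub_eq_zero, mul_comm] at this
      exact mul_right_cancel₀ hi this
    have hphi := hP.phi_coeff_eq hX (s := r)
      (hr.trans (by exact_mod_cast Nat.lt_succ_self (n * P.natDegree)))
      (by rw [hr' _ le_rfl, map_zero])
      (fun v => by rw [sub_smul, mul_smul, mul_smul, hrf, hrf, map_smul, sub_self])
    obtain ⟨p, rfl⟩ := exists_centralHom_eq hF hn0 hσ hdvd hphi
    refine ⟨⟨p, ?_⟩, LinearMap.ext hrf⟩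
    rw [Polynomial.mem_degreeLT]
    by_cases hp : p = 0
    · rw [hp, Polynomial.degree_zero]
      exact WithBot.bot_lt_coe _
    · rw [degree_centralHom hF hn0 hp] at hr
      rw [Polynomial.degree_eq_natDegree hp]
      norm_cast at hr ⊢
      exact lt_of_mul_lt_mul_left hr (Nat.zero_le n)

/-- Let E be the endomorphism ring, m = deg P and κ = dim_E V. Then |V| = |E|^κ gives nd = mκ, and
|End_E(V)| = |V|^κ gives n(dκ) = n(nm). Eliminating κ yields m² = d². -/
theorem natDegree_annihilator_polynomial [Finite F] [Finite K] (hn0 : n ≠ 0)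
    (hq : Nat.card F = q) (hK : Nat.card K = q ^ n)
    (hσ : ∀ x : K, σ x = x ↔ x ∈ Set.range (algebraMap F K))
    (hV : Nat.card V = Nat.card K ^ d)
    (hX : ∃ v : V, (SkewPolynomial.X : SkewPoly σ) • v ≠ 0) {P : F[X]}
    (hP : IsMinimalAnnihilator V
      (centralHom n (apply_algebraMap_of_fixed hσ) P) (n * P.natDegree)) :
    P.natDegree = d := by
  classical
  have h1 := card_moduleEnd hn0 hσ (iterate_eq_self_iff hσ hq hK) hX hP
  have h2 := card_end_moduleEnd hP
  have h3 : Nat.card V = Nat.card (Module.End (SkewPoly σ) V) ^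
    Module.finrank (Module.End (SkewPoly σ) V) V := Module.natCard_eq_pow_finrank
  rw [← Nat.card_congr ((Module.finBasis (Module.End (SkewPoly σ) V) V).constr ℕ).toEquiv,
    Nat.card_fun, Nat.card_fin, hV, hK] at h2
  rw [hV, h1, hK, hq] at h3
  have hq1 : 1 < q := hq ▸ Finite.one_lt_card
  simp only [← pow_mul] at h2 h3
  have h2 := Nat.pow_right_injective hq1 h2
  have h3 := Nat.pow_right_injective hq1 h3
  generalize Module.finrank (Module.End (SkewPoly σ) V) V = κ at h2 h3
  generalize P.natDegree = m at h2 h3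
  have h4 : d * κ = n * m := by
    have : n * (d * κ) = n * (n * m) := by rw [← mul_assoc, h2]
    exact Nat.eq_of_mul_eq_mul_left (Nat.pos_of_ne_zero hn0) this
  have h5 : n * (m * m) = n * (d * d) := by
    calc n * (m * m) = (n * m) * m := by ring
      _ = (m * κ) * d := by rw [← h4]; ring
      _ = n * (d * d) := by rw [← h3]; ring
  exact Nat.mul_self_inj.1 (Nat.eq_of_mul_eq_mul_left (Nat.pos_of_ne_zero hn0) h5)

end Dimension

/-! ### Central multiples and similarity of irreducible elements -/

section Similarity

variable {F : Type u} {K : Type v} [Field F] [Field K] [Algebra F K] {σ : K ≃+* K} {q n d : ℕ}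

/-- If `t` acts as zero on `R / R f`, then `f` is `t` up to a unit. -/
theorem exists_unit_mul_eq_X (hd : 1 ≤ d) {f : SkewPoly σ} (hf : degree f = d)
    (hX : ∀ v : QuotMod f, (SkewPolynomial.X : SkewPoly σ) • v = 0) :
    d = 1 ∧ ∃ w : (SkewPoly σ)ˣ, (w : SkewPoly σ) * f = SkewPolynomial.X := by
  have h1 := hX (quotMk f 1)
  rw [← map_smul, smul_eq_mul, mul_one, quotMk_eq_zero] at h1
  obtain ⟨w, hw⟩ := h1
  have hXdeg : degree (SkewPolynomial.X : SkewPoly σ) = (1 : ℕ) := degree_eq_iff.2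
    ⟨by simp, fun m hm => SkewPolynomial.coeff_X_of_ne_one (by omega)⟩
  have hw0 : w ≠ 0 := by
    rintro rfl
    rw [zero_mul] at hw
    exact SkewPolynomial.X_ne_zero hw.symm
  obtain ⟨k, hk⟩ := exists_degree_eq hw0
  have hdeg := congrArg degree hw
  rw [degree_mul, hk, hf, hXdeg] at hdeg
  norm_cast at hdeg
  obtain rfl : k = 0 := by omega
  obtain ⟨w, rfl⟩ := isUnit_of_degree_eq_zero hk
  exact ⟨by omega, w, hw⟩

/-- Every irreducible element of degree `d` right divides `P(t ^ n)` for a monic irreducible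
polynomial `P` of degree `d` over the fixed field. -/
theorem exists_central_multiple [Finite F] [Finite K] (hn0 : n ≠ 0) (hd : 1 ≤ d)
    (hq : Nat.card F = q) (hK : Nat.card K = q ^ n)
    (hσ : ∀ x : K, σ x = x ↔ x ∈ Set.range (algebraMap F K)) (f : IrrPoly σ d) :
    ∃ P : MonicIrr F d, ∃ w, w * f.1 = centralHom n (apply_algebraMap_of_fixed hσ) P.1 := by
  have hs := isSimpleModule_quotMod hd f.2.1 f.2.2
  have hfin := finite_quotMod f.2.1
  -- In the exceptional case t ∈ Rf, so f is t up to a unit and P = y works. Otherwise the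
  -- annihilating polynomial P works: applied to the class of 1, it says P(t^n) ∈ Rf.
  by_cases hX : ∀ v : QuotMod f.1, (SkewPolynomial.X : SkewPoly σ) • v = 0
  · obtain ⟨rfl, w, hw⟩ := exists_unit_mul_eq_X hd f.2.1 hX
    refine ⟨⟨Polynomial.X, Polynomial.monic_X, Polynomial.irreducible_X, Polynomial.natDegree_X⟩,
      (SkewPolynomial.X : SkewPoly σ) ^ (n - 1) * w, ?_⟩
    rw [centralHom_X, mul_assoc, hw, pow_sub_one_mul hn0]
  · push Not at hX
    obtain ⟨P, hmonic, hirr, hP⟩ :=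
      exists_annihilator_polynomial hn0 hσ (iterate_eq_self_iff hσ hq hK) hX
    refine ⟨⟨P, hmonic, hirr, natDegree_annihilator_polynomial hn0 hq hK hσ
      (card_quotMod f.2.1) hX hP⟩, ?_⟩
    have := hP.smul_eq_zero (quotMk f.1 1)
    rwa [← map_smul, smul_eq_mul, mul_one, quotMk_eq_zero] at this

/-- If `g` annihilates a nonzero vector of a simple module `V`, then `R / R g` is isomorphic
to `V`. -/
theorem nonempty_linearEquiv_of_smul_eq_zero {V : Type w} [AddCommGroup V] [Module (SkewPoly σ) V]
    [IsSimpleModule (SkewPoly σ) V] {g : SkewPoly σ} [IsSimpleModule (SkewPoly σ) (QuotMod g)]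
    {y : V} (hy : y ≠ 0) (h : g • y = 0) : Nonempty (QuotMod g ≃ₗ[SkewPoly σ] V) := by
  let T : QuotMod g →ₗ[SkewPoly σ] V := Submodule.liftQ _
    (LinearMap.toSpanSingleton (SkewPoly σ) V y) <| by
      rw [Submodule.span_singleton_le_iff_mem, LinearMap.mem_ker,
        LinearMap.toSpanSingleton_apply, h]
  refine ⟨LinearEquiv.ofBijective T (LinearMap.bijective_of_ne_zero fun h0 => hy ?_)⟩
  have h1 : T (quotMk g 1) = y := by simp [T, quotMk]
  rw [← h1, h0, LinearMap.zero_apply]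

/-- With V = R/Rf, the annihilator of V is generated by P(t^n). If g kills a nonzero vector of V,
then R/Rg maps isomorphically to V. Otherwise g would be invertible modulo RP(t^n), which lies in
Rg, and so R = Rg. -/
theorem nonempty_linearEquiv_of_X_smul_ne_zero [Finite K] (hn0 : n ≠ 0) (hd : 1 ≤ d)
    (hσ : ∀ x : K, σ x = x ↔ x ∈ Set.range (algebraMap F K))
    (hn : ∀ i, (∀ x, σ^[i] x = x) ↔ n ∣ i) (f g : IrrPoly σ d)
    {P : F[X]} (hmonic : P.Monic) (hirr : Irreducible P)
    (hfP : ∃ w, w * f.1 = centralHom n (apply_algebraMap_of_fixed hσ) P)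
    (hgP : ∃ w, w * g.1 = centralHom n (apply_algebraMap_of_fixed hσ) P)
    (hX : ∃ v : QuotMod f.1, (SkewPolynomial.X : SkewPoly σ) • v ≠ 0) :
    Nonempty (QuotMod g.1 ≃ₗ[SkewPoly σ] QuotMod f.1) := by
  have hsf := isSimpleModule_quotMod hd f.2.1 f.2.2
  have hsg := isSimpleModule_quotMod hd g.2.1 g.2.2
  have hfin := finite_quotMod f.2.1
  obtain ⟨Q, hQmonic, hQirr, hQ⟩ := exists_annihilator_polynomial hn0 hσ hn hX
  set hF := apply_algebraMap_of_fixed hσ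
  have hPV : ∀ v : QuotMod f.1, centralHom n hF P • v = 0 := by
    intro v
    obtain ⟨p, rfl⟩ := Submodule.mkQ_surjective _ v
    obtain ⟨w, hw⟩ := hfP
    refine (map_smul (quotMk f.1) _ p).symm.trans (quotMk_eq_zero.2 ⟨p * w, ?_⟩)
    rw [smul_eq_mul, ← commute_centralHom hF ((hn n).2 dvd_rfl), mul_assoc, hw]
  have hQP : Q = P := by
    -- The remainder evaluated at t^n still annihilates V, so it is zero by minimality; then Q
    -- divides P and both are irreducible.
    have hmod : P %ₘ Q = 0 := by
      by_contra hne
      refine hne (centralHom_injective hF hn0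
        ((hQ.eq_zero _ ?_ fun v => ?_).trans (map_zero _).symm))
      · rw [degree_centralHom hF hn0 hne]
        have := Polynomial.natDegree_modByMonic_lt P hQmonic
          (by rintro rfl; exact not_irreducible_one hQirr)
        exact_mod_cast Nat.mul_lt_mul_of_pos_left this (Nat.pos_of_ne_zero hn0)
      · rw [Polynomial.modByMonic_eq_sub_mul_div, map_sub, sub_smul, hPV, mul_comm, map_mul,
          mul_smul, hQ.smul_eq_zero, smul_zero, sub_zero]
    exact Polynomial.eq_of_monic_of_associated hQmonic hmonic
      (hQirr.associated_of_dvd hirr ((Polynomial.modByMonic_eq_zero_iff_dvd hQmonic).1 hmod))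
  subst hQP
  by_cases hinj : ∃ y : QuotMod f.1, y ≠ 0 ∧ g.1 • y = 0
  · obtain ⟨y, hy, h⟩ := hinj
    exact nonempty_linearEquiv_of_smul_eq_zero hy h
  · exfalso
    push Not at hinj
    have hG : Function.Injective (Module.toModuleEnd ℕ (S := SkewPoly σ) (QuotMod f.1) g.1) := by
      rw [injective_iff_map_eq_zero]
      intro y hy
      by_contra hne
      exact hinj y hne hy
    let π : Equiv.Perm (QuotMod f.1) := Equiv.ofBijective _ (Finite.injective_iff_bijective.1 hG)
    have hπ : ∀ (k : ℕ) v, (π ^ k) v = g.1 ^ k • v := by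
      intro k
      induction k with
      | zero => intro v; simp
      | succ k ih =>
        intro v
        rw [pow_succ, Equiv.Perm.mul_apply, ih, pow_succ, mul_smul]
        rfl
    -- `g` permutes the finite set V, so a power of it acts as 1, and that power minus 1 is a left
    -- multiple of P(t^n), hence of g. This puts 1 in Rg.
    obtain ⟨w, hw⟩ := hQ.eq_mul (s := g.1 ^ orderOf π - 1) fun v => by
      rw [sub_smul, ← hπ, pow_orderOf_eq_one, one_smul, Equiv.Perm.one_apply, sub_self]
    obtain ⟨w', hw'⟩ := hgP
    have h1 : quotMk g.1 1 = 0 := by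
      rw [quotMk_eq_zero]
      refine ⟨g.1 ^ (orderOf π - 1) - w * w', ?_⟩
      rw [sub_mul, pow_sub_one_mul (orderOf_pos π).ne', mul_assoc, hw', hw, sub_sub_cancel]
    have := IsSimpleModule.nontrivial (SkewPoly σ) (QuotMod g.1)
    obtain ⟨v, hv⟩ := exists_ne (0 : QuotMod g.1)
    obtain ⟨p, rfl⟩ := Submodule.mkQ_surjective _ v
    refine hv ?_
    change quotMk g.1 p = 0
    rw [← mul_one p, ← smul_eq_mul, map_smul, h1, smul_zero]

/-- Irreducible elements of degree `d` that right divide the same `P(t ^ n)`, `P` irreducible,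
are similar. -/
theorem nonempty_linearEquiv [Finite K] (hn0 : n ≠ 0) (hd : 1 ≤ d)
    (hσ : ∀ x : K, σ x = x ↔ x ∈ Set.range (algebraMap F K))
    (hn : ∀ i, (∀ x, σ^[i] x = x) ↔ n ∣ i) (f g : IrrPoly σ d)
    {P : F[X]} (hmonic : P.Monic) (hirr : Irreducible P)
    (hfP : ∃ w, w * f.1 = centralHom n (apply_algebraMap_of_fixed hσ) P)
    (hgP : ∃ w, w * g.1 = centralHom n (apply_algebraMap_of_fixed hσ) P) :
    Nonempty (QuotMod f.1 ≃ₗ[SkewPoly σ] QuotMod g.1) := by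
  by_cases hXf : ∃ v : QuotMod f.1, (SkewPolynomial.X : SkewPoly σ) • v ≠ 0
  · exact (nonempty_linearEquiv_of_X_smul_ne_zero hn0 hd hσ hn f g hmonic hirr hfP hgP hXf).map
      LinearEquiv.symm
  by_cases hXg : ∃ v : QuotMod g.1, (SkewPolynomial.X : SkewPoly σ) • v ≠ 0
  · exact nonempty_linearEquiv_of_X_smul_ne_zero hn0 hd hσ hn g f hmonic hirr hgP hfP hXg
  -- If t acts as zero on both modules, f and g are both unit multiples of t and generate the same
  -- left ideal.
  push Not at hXf hXg
  obtain ⟨-, a, ha⟩ := exists_unit_mul_eq_X hd f.2.1 hXf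
  obtain ⟨-, b, hb⟩ := exists_unit_mul_eq_X hd g.2.1 hXg
  refine ⟨Submodule.quotEquivOfEq _ _ (le_antisymm ?_ ?_)⟩
  · rw [Submodule.span_singleton_le_iff_mem, Submodule.mem_span_singleton]
    exact ⟨(a⁻¹ : (SkewPoly σ)ˣ) * b, by rw [smul_eq_mul, mul_assoc, hb, ← ha]; simp⟩
  · rw [Submodule.span_singleton_le_iff_mem, Submodule.mem_span_singleton]
    exact ⟨(b⁻¹ : (SkewPoly σ)ˣ) * a, by rw [smul_eq_mul, mul_assoc, ha, ← hb]; simp⟩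

end Similarity

/-! ### Semilinear automorphisms of `K[t;σ]` -/

section Semilinear

variable {K : Type v} [Field K] {σ : K ≃+* K} {d : ℕ}

theorem C_mul_X_pow (a : Twisted σ) (k : ℕ) :
    (SkewPolynomial.C a * SkewPolynomial.X : SkewPoly σ) ^ k =
      SkewPolynomial.monomial k (∏ i ∈ Finset.range k, (SkewPolynomial.φ)^[i] a) := by
  induction k with
  | zero => simp [SkewPolynomial.C_1]
  | succ k ih =>
    rw [pow_succ, ih, SkewPolynomial.C_mul_X_eq_monomial, SkewPolynomial.monomial_mul_monomial,
      Finset.prod_range_succ]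

/-- `τ` as an automorphism of the tagged copy of `K`. -/
def twistedAut (σ τ : K ≃+* K) : Twisted σ →+* Twisted σ := (τ : K →+* K)

theorem twistedAut_iterate_phi {τ : K ≃+* K} (hτ : ∀ x, τ (σ x) = σ (τ x)) (k : ℕ)
    (a : Twisted σ) : twistedAut σ τ ((SkewPolynomial.φ)^[k] a) =
      (SkewPolynomial.φ)^[k] (twistedAut σ τ a) := by
  refine (Function.Semiconj.iterate_right (f := twistedAut σ τ) (fun x => ?_) k) a
  exact (congrArg (twistedAut σ τ) (phi_apply x)).trans
    ((congrArg (toTwisted σ) (hτ x)).trans (phi_apply (τ x)).symm)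

/-- The semilinear endomorphism `∑ aᵢ tⁱ ↦ ∑ τ(aᵢ) (a t)ⁱ` of `K[t;σ]`. -/
def semilinearHom (τ : K ≃+* K) (hτ : ∀ x, τ (σ x) = σ (τ x)) (a : Twisted σ) :
    SkewPoly σ →+* SkewPoly σ :=
  SkewMonoidAlgebra.liftNCRingHom (SkewPolynomial.CRingHom.comp (twistedAut σ τ))
    (powersHom _ (SkewPolynomial.C a * SkewPolynomial.X)) <| by
      -- The required relation is τ(σ^k x)(at)^k = (at)^k τ(x), which holds because τ commutes with
      -- σ and K is commutative.
      intro x y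
      rw [← ofAdd_toAdd y, ← SkewPolynomial.φ_iterate_apply, powersHom_apply, toAdd_ofAdd,
        C_mul_X_pow]
      change SkewPolynomial.C (twistedAut σ τ _) * _ = _ * SkewPolynomial.C (twistedAut σ τ x)
      rw [SkewPolynomial.C_mul_monomial, SkewPolynomial.monomial_mul_C, twistedAut_iterate_phi hτ,
        mul_comm]

variable {τ : K ≃+* K} (hτ : ∀ x, τ (σ x) = σ (τ x)) (a : Twisted σ)

theorem semilinearHom_monomial (k : ℕ) (c : Twisted σ) :
    semilinearHom τ hτ a (SkewPolynomial.monomial k c) = SkewPolynomial.monomial k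
      (twistedAut σ τ c * ∏ i ∈ Finset.range k, (SkewPolynomial.φ)^[i] a) := by
  refine (SkewMonoidAlgebra.liftNC_single _ _ _ _).trans ?_
  change SkewPolynomial.C (twistedAut σ τ c) * (SkewPolynomial.C a * SkewPolynomial.X) ^ k = _
  rw [C_mul_X_pow, SkewPolynomial.C_mul_monomial]

theorem coeff_semilinearHom (p : SkewPoly σ) (k : ℕ) :
    (semilinearHom τ hτ a p).coeff k =
      twistedAut σ τ (p.coeff k) * ∏ i ∈ Finset.range k, (SkewPolynomial.φ)^[i] a := by
  induction p using SkewPolynomial.induction with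
  | h0 => simp
  | ha j r p hj hr ih =>
    rw [map_add, SkewPolynomial.coeff_add, ih, semilinearHom_monomial, SkewPolynomial.coeff_monomial,
      SkewPolynomial.coeff_add, SkewPolynomial.coeff_monomial, map_add, add_mul]
    split_ifs with h
    · rw [h]
    · simp

variable {a}

theorem coeff_semilinearHom_eq_zero (ha : a ≠ 0) (p : SkewPoly σ) (k : ℕ) :
    (semilinearHom τ hτ a p).coeff k = 0 ↔ p.coeff k = 0 := by
  rw [coeff_semilinearHom, mul_eq_zero, or_iff_left, map_eq_zero]
  exact Finset.prod_ne_zero_iff.2 fun i _ => iterate_phi_ne_zero ha i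

theorem degree_semilinearHom (ha : a ≠ 0) (p : SkewPoly σ) :
    degree (semilinearHom τ hτ a p) = degree p := by
  have : (semilinearHom τ hτ a p).support = p.support := by
    ext k
    rw [SkewPolynomial.mem_support_iff, SkewPolynomial.mem_support_iff, Ne, Ne,
      coeff_semilinearHom_eq_zero hτ ha]
  rw [degree, degree, this]

/-- A semilinear automorphism permutes the elements of degree less than `d`. -/
def semilinearEquiv [Finite K] (d : ℕ) (ha : a ≠ 0) : degreeLT σ d ≃+ degreeLT σ d :=
  AddEquiv.ofBijective
    (((semilinearHom τ hτ a).toAddMonoidHom.comp (degreeLT σ d).subtype).codRestrict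
      (degreeLT σ d) fun p => (degree_semilinearHom hτ ha p.1).trans_lt p.2) <| by
    -- Preservation of degree gives a zero kernel, and finiteness does the rest, so no inverse map
    -- is constructed.
    rw [← Finite.injective_iff_bijective, injective_iff_map_eq_zero]
    intro p hp
    have h0 : semilinearHom τ hτ a p.1 = 0 := congrArg Subtype.val hp
    refine Subtype.ext (degree_eq_bot.1 ?_)
    rw [← degree_semilinearHom hτ ha, h0, degree_zero]

theorem semilinearEquiv_apply [Finite K] (ha : a ≠ 0) (p : degreeLT σ d) :
    (semilinearEquiv hτ d ha p).1 = semilinearHom τ hτ a p.1 := rfl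

/-- Factors of degree less than d lie in the image, so a factorization pulls back to f. -/
theorem isIrreducible_semilinearHom [Finite K] (ha : a ≠ 0) {f : SkewPoly σ} (hf : degree f = d)
    (hirr : IsIrreducible f) : IsIrreducible (semilinearHom τ hτ a f) := by
  rintro ⟨p, p', hp, hp', h⟩
  rw [degree_semilinearHom, hf] at hp hp'
  · obtain ⟨s, hs⟩ := (semilinearEquiv hτ d ha).surjective ⟨p, hp⟩
    obtain ⟨s', hs'⟩ := (semilinearEquiv hτ d ha).surjective ⟨p', hp'⟩
    have hs := congrArg Subtype.val hs
    have hs' := congrArg Subtype.val hs'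
    rw [semilinearEquiv_apply] at hs hs'
    refine hirr ⟨s.1, s'.1, s.2.trans_eq hf.symm, s'.2.trans_eq hf.symm, ?_⟩
    rw [← sub_eq_zero, ← degree_eq_bot, ← degree_semilinearHom hτ ha, map_sub, map_mul, hs, hs', h,
      sub_self, degree_zero]
  all_goals exact ha

/-- The image of an irreducible element under a semilinear automorphism. -/
def IrrPoly.semilinear [Finite K] (ha : a ≠ 0) (f : IrrPoly σ d) : IrrPoly σ d :=
  ⟨semilinearHom τ hτ a f.1, (degree_semilinearHom hτ ha f.1).trans f.2.1,
    isIrreducible_semilinearHom hτ ha f.2.1 f.2.2⟩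

/-- A degree-preserving ring homomorphism carries division with remainder by f to division by the
image of f, so all three maps can be the same. -/
theorem isotopic_semilinear [Finite K] (ha : a ≠ 0) (f : IrrPoly σ d) :
    Isotopic (Sf f) (Sf (f.semilinear hτ ha)) := by
  let E : Sf f ≃+ Sf (f.semilinear hτ ha) := semilinearEquiv hτ d ha
  have hE : ∀ x, (E x).1 = semilinearHom τ hτ a x.1 := fun _ => rfl
  refine ⟨E, E, E, fun x y => ?_⟩
  apply (SfEquiv (f.semilinear hτ ha)).injective
  rw [SfEquiv_mul]
  obtain ⟨w, hw⟩ := modRight_spec f (x.1 * y.1)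
  change (E x).1 • quotMk _ (E y).1 = quotMk _ (E (x * y)).1
  rw [← map_smul, smul_eq_mul, ← sub_eq_zero, ← map_sub, quotMk_eq_zero, hE, hE, hE, ← map_mul]
  refine ⟨semilinearHom τ hτ a w, ?_⟩
  change _ = _ - semilinearHom τ hτ a (modRight f (x.1 * y.1))
  rw [eq_sub_iff_add_eq]
  conv_rhs => rw [hw]
  rw [map_add, map_mul]
  rfl

end Semilinear

/-! ### Lifting the action of ΓL(1,F) to K[t;σ] -/

section Action

variable {F : Type u} {K : Type v} [Field F] [Field K] [Algebra F K] {σ : K ≃+* K} {n d : ℕ}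

/-- (at)^n is the product of the σ-conjugates of a times t^n, that is ct^n, and τ restricts to ρ on
F. -/
theorem semilinearHom_centralHom (hF : ∀ x : F, σ (algebraMap F K x) = algebraMap F K x)
    {τ : K ≃+* K} (hτ : ∀ x, τ (σ x) = σ (τ x)) {ρ : F ≃+* F}
    (hτρ : ∀ x, τ (algebraMap F K x) = algebraMap F K (ρ x)) {a : K} {c : F}
    (ha : ∏ i ∈ Finset.range n, σ^[i] a = algebraMap F K c) (P : F[X]) :
    semilinearHom τ hτ (toTwisted σ a) (centralHom n hF P) =
      centralHom n hF ((P.map (ρ : F →+* F)).comp (Polynomial.C c * Polynomial.X)) := by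
  have hprod : ∏ i ∈ Finset.range n, (SkewPolynomial.φ)^[i] (toTwisted σ a) = toTw F σ c := by
    simp only [iterate_phi_apply, RingEquiv.symm_apply_apply]
    rw [← map_prod, ha]
    rfl
  have hC : ∀ x : F, twistedAut σ τ (toTw F σ x) = toTw F σ (ρ x) := hτρ
  have h : (semilinearHom τ hτ (toTwisted σ a)).comp (centralHom n hF) =
      (centralHom n hF).comp ((Polynomial.compRingHom (Polynomial.C c * Polynomial.X)).comp
        (Polynomial.mapRingHom (ρ : F →+* F))) := by
    refine Polynomial.ringHom_ext (fun x => ?_) ?_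
    · simp only [RingHom.comp_apply, Polynomial.coe_compRingHom_apply, Polynomial.coe_mapRingHom,
        Polynomial.map_C, Polynomial.C_comp, centralHom_C]
      rw [← SkewPolynomial.monomial_zero_left, semilinearHom_monomial, hC]
      simp
    · simp only [RingHom.comp_apply, Polynomial.coe_compRingHom_apply, Polynomial.coe_mapRingHom,
        Polynomial.map_X, Polynomial.X_comp]
      rw [centralHom_X, map_mul, centralHom_C, centralHom_X,
        ← SkewPolynomial.monomial_one_right_eq_X_pow, semilinearHom_monomial, hprod, map_one,
        one_mul, SkewPolynomial.C_mul_monomial, mul_one]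
  exact RingHom.congr_fun h P

/-- Irreducible elements whose central multiples are in the same `ΓL(1,F)`-orbit give isotopic
semifields. -/
theorem isotopic_of_smul_eq [Finite F] [Finite K] {q : ℕ} (hn0 : n ≠ 0) (hd : 1 ≤ d)
    (hq : Nat.card F = q) (hK : Nat.card K = q ^ n)
    (hσ : ∀ x : K, σ x = x ↔ x ∈ Set.range (algebraMap F K)) {f g : IrrPoly σ d}
    {P Q : MonicIrr F d}
    (hfP : ∃ w, w * f.1 = centralHom n (apply_algebraMap_of_fixed hσ) P.1)
    (hgQ : ∃ w, w * g.1 = centralHom n (apply_algebraMap_of_fixed hσ) Q.1)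
    {γ : GammaL1 F} (hγ : γ • P = Q) : Isotopic (Sf f) (Sf g) := by
  obtain ⟨τ, hτρ, hτ⟩ := exists_extension_commuting (K := K) γ.right σ
  obtain ⟨a, ha⟩ := exists_prod_iterate_eq hσ hq hK (γ.left : F)
  have ha0 : toTwisted σ a ≠ 0 := by
    intro h
    have h0 : a = 0 := (map_eq_zero _).1 h
    have hc : algebraMap F K (γ.left : F) ≠ 0 := by simp
    refine hc (ha.symm.trans (Finset.prod_eq_zero (Finset.mem_range.2 (Nat.pos_of_ne_zero hn0)) ?_))
    rw [h0]
    rfl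
  set hF := apply_algebraMap_of_fixed hσ
  have hQ : Q.1 = twistPoly d γ P.1 := congrArg Subtype.val hγ.symm
  have hf' : ∃ w, w * (f.semilinear hτ ha0).1 = centralHom n hF Q.1 := by
    obtain ⟨w, hw⟩ := hfP
    -- The constant λ^{-d} is the normalizing factor in `twistPoly`.
    refine ⟨centralHom n hF (Polynomial.C (((γ.left : F)⁻¹) ^ d)) *
      semilinearHom τ hτ (toTwisted σ a) w, ?_⟩
    change _ * semilinearHom τ hτ (toTwisted σ a) f.1 = _
    rw [mul_assoc, ← map_mul, hw, semilinearHom_centralHom hF hτ hτρ ha, ← map_mul, hQ]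
    rfl
  obtain ⟨e⟩ := nonempty_linearEquiv hn0 hd hσ (iterate_eq_self_iff hσ hq hK) _ g Q.2.1 Q.2.2.1
    hf' hgQ
  exact (isotopismSetoid σ d).iseqv.trans (isotopic_semilinear hτ ha0 f)
    (isotopic_of_linearEquiv _ g e)

end Action

end SkewSemifield

end

theorem mainTheorem1 {F K : Type*} [Field F] [Finite F] [Field K] [Finite K] [Algebra F K]
    (q n d : ℕ) (hq : Nat.card F = q) (hn : Nat.card K = q ^ n) (hd : 1 ≤ d)
    (σ : K ≃+* K) (hσ : ∀ x : K, σ x = x ↔ x ∈ Set.range (algebraMap F K)) :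
    (∀ f : SkewSemifield.IrrPoly σ d,
      SkewSemifield.IsFiniteSemifield (SkewSemifield.Sf f) ∧
        Nat.card (SkewSemifield.Sf f) = q ^ (n * d)) ∧
    Nat.card (SkewSemifield.IsotopismClasses σ d) ≤ Nat.card (SkewSemifield.GammaL1Orbits F d) := by
  open SkewSemifield in
  -- For `n = 0` the field K would have one element.
  have hn0 : n ≠ 0 := by
    rintro rfl
    have : 1 < Nat.card K := Finite.one_lt_card
    rw [hn, pow_zero] at this
    exact lt_irrefl 1 this
  refine ⟨fun f => ⟨isFiniteSemifield_Sf hd f, by rw [card_Sf, hn, pow_mul]⟩, ?_⟩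
  choose P hP using exists_central_multiple hn0 hd hq hn hσ
  refine Nat.card_le_card_of_injective
    (fun c : IsotopismClasses σ d => (Quotient.mk'' (P c.out) : GammaL1Orbits F d)) ?_
  intro c c' h
  -- Here γ moves the polynomial of `c'` to that of `c`, so the isotopism runs from `c'` to `c` and
  -- is reversed at the end.
  obtain ⟨γ, hγ⟩ := MulAction.orbitRel_apply.1 (Quotient.exact h)
  rw [← Quotient.out_eq c, ← Quotient.out_eq c']
  exact (Quotient.sound (isotopic_of_smul_eq hn0 hd hq hn hσ (hP c'.out) (hP c.out) hγ)).symm
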